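/- Graphs are finite, simple and undirected. $P_m$ denotes the path on $m$ vertices, and a graph is $P_m$-free if it contains no induced subgraph isomorphic to $P_m$. The vertices of an $n$-vertex graph carry distinct identifiers on $O(\log n)$ bits, namely in $\{1,\dots,n^c\}$ for a fixed constant $c$. Given an assignment of certificates (bit strings) to the vertices, the view of a vertex $v$ at distance $d$ consists of the vertices at distance at most $d$ from $v$ with their identifiers and certificates, and of all edges between these vertices except those joining two vertices at distance exactly $d$ from $v$. A local certification of size $s$ with verification radius $d$ for a graph property $\mathcal P$ is a verification algorithm, that is, a function of the view at distance $d$ with values accept/reject, the same for all graphs, identifier assignments and vertices, such that for every $n$-vertex graph $G$ and every identifier assignment: (1) if $G$ satisfies $\mathcal P$, there is an assignment of certificates of at most $s(n)$ bits for which every vertex accepts; (2) if $G$ does not satisfy $\mathcal P$, then for every assignment of certificates (of any size) at least one vertex rejects. **Theorem.** For every $k\ge 2$ (and every $c$) there is a function $s(n)=O(n^{3/2}\log^2 n)$ such that the property of being $P_{\lceil 14k/3\rceil-1}$-free has a local certification of size $s$ with verification radius $k$. The implied constant may depend on $k$ and $c$. -/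

import Mathlib

open Filter Asymptotics

/-- `G` is `H`-free: it contains no *induced* subgraph isomorphic to `H`
(`IsIndContained` is the existence of a graph embedding, i.e. an injective map preserving
both adjacency and non-adjacency). -/
def InducedFree {U V : Type} (H : SimpleGraph U) (G : SimpleGraph V) : Prop :=
  ¬ H.IsIndContained G

/-- Unique identifiers on `O(log n)` bits: an injective map from the vertices of an `n`-vertex
graph to `{1, …, n ^ c}`. -/
def IsIdentifierAssignment (c : ℕ) {V : Type} [Fintype V] (ident : V → ℕ) : Prop :=
  Function.Injective ident ∧ ∀ v, 1 ≤ ident v ∧ ident v ≤ Fintype.card V ^ c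

/-- What a vertex of a network can see: its own identifier, the identifiers of the visible vertices
together with their certificates (bit strings), and the visible edges. Vertices occur only
through their identifiers. -/
@[ext]
structure LocalView where
  /-- the identifier of the vertex whose view this is -/
  center : ℕ
  /-- the visible vertices, each given by its identifier together with its certificate -/
  labels : Set (ℕ × List Bool)
  /-- the visible edges, each given by the identifiers of its endpoints -/
  edges : Set (Sym2 ℕ)

/-- The view at distance `d` of the vertex `v`: the vertices at distance at most `d` from `v`, with
their identifiers and certificates, and the edges between these vertices, except those joining
two vertices at distance exactly `d`. Distances are `ℕ∞`-valued, so that vertices in other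
connected components are at distance `⊤`. -/
def viewAt {V : Type} (G : SimpleGraph V) (ident : V → ℕ) (cert : V → List Bool)
    (d : ℕ) (v : V) : LocalView where
  center := ident v
  labels := {p | ∃ u, G.edist v u ≤ d ∧ p = (ident u, cert u)}
  edges := {e | ∃ u w, G.Adj u w ∧ G.edist v u ≤ d ∧ G.edist v w ≤ d ∧
    ¬ (G.edist v u = d ∧ G.edist v w = d) ∧ e = s(ident u, ident w)}

/-- There is a local certification of size `s` with verification radius `d` for the graph
property `P`, on networks whose `n`-vertex members carry unique identifiers in `{1, …, n ^ c}`.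
The verification algorithm `accept` is one function of the view at distance `d`, the same for
all graphs, all identifier assignments and all vertices.
* Completeness: if `G` satisfies `P`, some assignment of certificates of at most `s n` bits makes
  every vertex accept.
* Soundness: if `G` does not satisfy `P`, then for every assignment of certificates (of any size)
  at least one vertex rejects. -/
def HasLocalCertification (P : ∀ V : Type, SimpleGraph V → Prop) (d c : ℕ) (s : ℕ → ℕ) : Prop :=
  ∃ accept : LocalView → Bool,
    ∀ (V : Type) [Fintype V] (G : SimpleGraph V) (ident : V → ℕ),
      IsIdentifierAssignment c ident →
        (P V G → ∃ cert : V → List Bool,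
          (∀ v, (cert v).length ≤ s (Fintype.card V)) ∧
            ∀ v, accept (viewAt G ident cert d v) = true) ∧
        (¬ P V G → ∀ cert : V → List Bool,
          ∃ v, accept (viewAt G ident cert d v) = false)

/-!
Write `k = r + 1` and call a vertex *big* if its degree is at least of order `√n log n`. The big
vertices fall into clusters: two of them are linked if one can go from one to the other through big
vertices by jumps of length at most `2 * r`. A certificate contains the rows of the adjacency matrix
of all the vertices that are not big, the cluster of each big vertex, tables of the shapes of the
pieces of induced paths around the clusters, partly shared by all the vertices, and the rows of
about `√n` of the big vertices. Since a big vertex has many neighbours, these few rows can be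
distributed by a random colouring of the vertices in such a way that each big vertex finds the rows
of all the big vertices among its neighbours. A vertex accepts if what it sees is compatible with
some path-free graph, its *belief*; all the vertices within distance `r` of a cluster then have the
same belief.

Suppose that all the vertices accept a graph with an induced path on `N` vertices, where
`3 * N < 14 * k`. The belief of a vertex `w` is wrong only inside the clusters not linked to `w`.
If, for each of them that the path meets, the belief contained a *detour*, a piece of path that
replaces the part of the path close to this cluster, then following all the detours would give an
induced path in the belief. So the path meets a cluster without detour. For every `h ≤ r` it has at
least two vertices at distance `h` from this cluster, since the shared part of the tables provides a
detour if there is just one. Thus there are two such clusters, and counting shows that one of them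
has a distance at which the path has just two vertices, one of them at distance less than `2 * k`
from the other cluster. A vertex halfway between them has the belief of the other cluster and knows
the piece of path between these two vertices, which gives a detour. Hence there is a third cluster
that the path visits twice at every distance, and the path has at least `6 * k` vertices, too many.
-/

open scoped Finset

section Levels

variable {N k h : ℕ} {f g : ℕ → ℕ}

lemma card_filter_add_card_filter_le {α : Type*} {s : Finset α} {p q t : α → Prop}
    [DecidablePred p] [DecidablePred q] [DecidablePred t] (hp : ∀ x ∈ s, p x → t x)
    (hq : ∀ x ∈ s, q x → t x) (hpq : ∀ x ∈ s, p x → ¬ q x) :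
    #{x ∈ s | p x} + #{x ∈ s | q x} ≤ #{x ∈ s | t x} := by
  classical
  rw [← Finset.card_union_of_disjoint (Finset.disjoint_filter.2 hpq), ← Finset.filter_or]
  refine Finset.card_le_card fun x hx ↦ ?_
  simp only [Finset.mem_filter] at hx ⊢
  exact ⟨hx.1, hx.2.elim (hp x hx.1) (hq x hx.1)⟩

/-- `f` moves by at most one at each step below `N`, like the distance to a fixed set along a
path on `N` vertices. -/
def SmallSteps (N : ℕ) (f : ℕ → ℕ) : Prop :=
  ∀ i, i + 1 < N → f (i + 1) ≤ f i + 1 ∧ f i ≤ f (i + 1) + 1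

/-- The indices below `N` at which `f` takes the value `h`. -/
def levelSet (N : ℕ) (f : ℕ → ℕ) (h : ℕ) : Finset ℕ := {s ∈ Finset.range N | f s = h}

lemma mem_levelSet {s : ℕ} : s ∈ levelSet N f h ↔ s < N ∧ f s = h := by simp [levelSet]

lemma SmallSteps.exists_mem_uIcc_eq (hf : SmallSteps N f) {a b c : ℕ} (ha : a < N) (hb : b < N)
    (hc : c ∈ Set.uIcc (f a) (f b)) : ∃ i ∈ Set.uIcc a b, f i = c := by
  wlog hab : a ≤ b generalizing a b
  · rw [Set.uIcc_comm] at hc ⊢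
    exact this hb ha hc (le_of_not_ge hab)
  induction b, hab using Nat.le_induction with
  | base => exact ⟨a, Set.left_mem_uIcc, by simpa [eq_comm] using hc⟩
  | succ b hab ih =>
    obtain rfl | hne := eq_or_ne c (f (b + 1))
    · exact ⟨b + 1, Set.right_mem_uIcc, rfl⟩
    · have hstep := hf b hb
      have hcb : c ∈ Set.uIcc (f a) (f b) := by
        rw [Set.mem_uIcc] at hc ⊢
        omega
      obtain ⟨i, hi, hfi⟩ := ih ((Nat.lt_succ_self b).trans hb) hcb
      exact ⟨i, Set.uIcc_subset_uIcc_left (Set.mem_uIcc.2 (.inl ⟨hab, b.le_succ⟩)) hi, hfi⟩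

lemma mul_sub_le_card_of_card_levelSet_ge {a b c : ℕ}
    (hc : ∀ x, a ≤ x → x < b → c ≤ #(levelSet N f x)) :
    c * (b - a) ≤ #{s ∈ Finset.range N | a ≤ f s ∧ f s < b} := by
  rw [← Nat.card_Ico]
  refine Finset.mul_card_image_le_card_of_maps_to (f := f) (fun s hs ↦ ?_) c fun x hx ↦ ?_
  · simpa using (Finset.mem_filter.1 hs).2
  · rw [Finset.mem_Ico] at hx
    refine (hc x hx.1 hx.2).trans (Finset.card_le_card fun s hs ↦ ?_)
    simp only [mem_levelSet, Finset.mem_filter, Finset.mem_range] at hs ⊢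
    omega

/-- Between a zero `a` of `g` and the index of level `h` closest to it, `f` stays above `h`, while
`g` takes all the values below `2 * k`. -/
lemma le_card_above_level (hf : SmallSteps N f) (hg : SmallSteps N g) {a : ℕ} (ha : a < N)
    (hga : g a = 0) (hfa : h < f a) (hne : (levelSet N f h).Nonempty)
    (hfar : ∀ x ∈ levelSet N f h, 2 * k ≤ g x) :
    k ≤ #{s ∈ Finset.range N | h < f s ∧ k ≤ g s} := by
  obtain ⟨x, hx, hclosest⟩ := (levelSet N f h).exists_min_image (fun x ↦ x - a + (a - x)) hne
  have hgx := hfar x hx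
  rw [mem_levelSet] at hx
  have hsurj : Set.SurjOn g ({s ∈ Finset.range N | h < f s ∧ k ≤ g s} : Finset ℕ)
      (Finset.Ico k (2 * k)) := by
    intro c hc
    rw [Finset.coe_Ico, Set.mem_Ico] at hc
    obtain ⟨i, hi, rfl⟩ := hg.exists_mem_uIcc_eq hx.1 ha
      (Set.mem_uIcc.2 (.inr ⟨hga.trans_le c.zero_le, hc.2.le.trans hgx⟩))
    rw [Set.mem_uIcc] at hi
    have hix : i ≠ x := by rintro rfl; omega
    refine ⟨i, ?_, rfl⟩
    suffices h < f i by simp; omega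
    by_contra! hfi
    obtain ⟨j, hj, hfj⟩ := hf.exists_mem_uIcc_eq (by omega) ha (Set.mem_uIcc.2 (.inl ⟨hfi, hfa.le⟩))
    rw [Set.mem_uIcc] at hj
    have := hclosest j (mem_levelSet.2 ⟨by omega, hfj⟩)
    omega
  have := Finset.card_le_card_of_surjOn g hsurj
  rw [Nat.card_Ico] at this
  omega

lemma seven_mul_le_card_add_three_mul_card (hk : 1 ≤ k) (hf : SmallSteps N f)
    (hg : SmallSteps N g) (hfg : ∀ s < N, 2 * k ≤ f s + g s + 1)
    (hf2 : ∀ h < k, 2 ≤ #(levelSet N f h)) (hg0 : (levelSet N g 0).Nonempty)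
    (hfar : ∀ h < k, #(levelSet N f h) = 2 → ∀ x ∈ levelSet N f h, 2 * k ≤ g x) :
    7 * k ≤ #{s ∈ Finset.range N | k ≤ f s ∧ k ≤ g s} + 3 * #{s ∈ Finset.range N | f s < k} := by
  obtain hno | hex := ({h ∈ Finset.range k | #(levelSet N f h) = 2} : Finset ℕ).eq_empty_or_nonempty
  · have hthree := mul_sub_le_card_of_card_levelSet_ge (N := N) (f := f) (a := 0) (b := k) (c := 3)
      fun x _ hx ↦ by
        have := hf2 x hx
        have := Finset.filter_eq_empty_iff.1 hno (Finset.mem_range.2 hx)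
        omega
    simp only [zero_le, true_and] at hthree
    omega
  · obtain ⟨h, hh, hmax⟩ := Finset.exists_max_image _ id hex
    simp only [Finset.mem_filter, Finset.mem_range, id] at hh hmax
    obtain ⟨a, ha⟩ := hg0
    rw [mem_levelSet] at ha
    have habove : k ≤ #{s ∈ Finset.range N | h < f s ∧ k ≤ g s} :=
      le_card_above_level hf hg ha.1 ha.2 (by have := hfg a ha.1; omega)
        (Finset.card_pos.1 (by omega)) (hfar h hh.1 hh.2)
    have hthree : 3 * (k - (h + 1)) ≤ #{s ∈ Finset.range N | h + 1 ≤ f s ∧ f s < k} :=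
      mul_sub_le_card_of_card_levelSet_ge fun x hx hxk ↦ by
        have := hf2 x hxk
        have := mt (hmax x) (by omega)
        omega
    have htwo : 2 * (h + 1 - 0) ≤ #{s ∈ Finset.range N | 0 ≤ f s ∧ f s < h + 1} :=
      mul_sub_le_card_of_card_levelSet_ge fun x _ hx ↦ hf2 x (by omega)
    have hlow : #{s ∈ Finset.range N | h + 1 ≤ f s ∧ f s < k} +
        #{s ∈ Finset.range N | 0 ≤ f s ∧ f s < h + 1} ≤ #{s ∈ Finset.range N | f s < k} :=
      card_filter_add_card_filter_le (by omega) (by omega) (by omega)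
    have hcover : #{s ∈ Finset.range N | h < f s ∧ k ≤ g s} ≤
        #{s ∈ Finset.range N | k ≤ f s ∧ k ≤ g s} +
          #{s ∈ Finset.range N | h + 1 ≤ f s ∧ f s < k} := by
      refine (Finset.card_le_card fun s hs ↦ ?_).trans (Finset.card_union_le _ _)
      simp only [Finset.mem_filter, Finset.mem_union] at hs ⊢
      have := lt_or_ge (f s) k
      tauto
    omega

lemma exists_visible_level (hk : 1 ≤ k) (hN : 3 * N < 14 * k)
    (hf : SmallSteps N f) (hg : SmallSteps N g) (hfg : ∀ s < N, 2 * k ≤ f s + g s + 1)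
    (hf2 : ∀ h < k, 2 ≤ #(levelSet N f h)) (hg2 : ∀ h < k, 2 ≤ #(levelSet N g h)) :
    (∃ h < k, #(levelSet N f h) = 2 ∧ ∃ x ∈ levelSet N f h, g x < 2 * k) ∨
    (∃ h < k, #(levelSet N g h) = 2 ∧ ∃ x ∈ levelSet N g h, f x < 2 * k) := by
  by_contra! hfar
  have hzero {f : ℕ → ℕ} (hf2 : ∀ h < k, 2 ≤ #(levelSet N f h)) : (levelSet N f 0).Nonempty :=
    Finset.card_pos.1 (zero_lt_two.trans_le (hf2 0 hk))
  have hcardf := seven_mul_le_card_add_three_mul_card hk hf hg hfg hf2 (hzero hg2) hfar.1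
  have hcardg := seven_mul_le_card_add_three_mul_card hk hg hf
    (fun s hs ↦ by rw [add_comm (g s)]; exact hfg s hs) hg2 (hzero hf2) hfar.2
  simp only [and_comm (a := k ≤ g _)] at hcardg
  have hsmall : #{s ∈ Finset.range N | f s < k} + #{s ∈ Finset.range N | g s < k} ≤
      #{s ∈ Finset.range N | ¬ (k ≤ f s ∧ k ≤ g s)} :=
    card_filter_add_card_filter_le (by omega) (by omega) fun s hs ↦ by
      have := hfg s (Finset.mem_range.1 hs)
      omega
  have htotal := Finset.card_filter_add_card_filter_not (s := Finset.range N)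
    (fun s ↦ k ≤ f s ∧ k ≤ g s)
  rw [Finset.card_range] at htotal
  omega

end Levels

section Distance

variable {W : Type*} {Γ H : SimpleGraph W} {m n : ℕ} {x y z : W}

lemma edist_le_succ_iff :
    Γ.edist x z ≤ (n + 1 : ℕ) ↔ Γ.edist x z ≤ n ∨ ∃ y, Γ.edist x y ≤ n ∧ Γ.Adj y z := by
  constructor
  · intro h
    obtain ⟨p, hp⟩ :=
      SimpleGraph.exists_walk_of_edist_ne_top (h.trans_lt (ENat.natCast_lt_top _)).ne
    cases hrev : p.reverse with
    | nil => simp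
    | cons hadj q =>
      refine .inr ⟨_, SimpleGraph.edist_comm.trans_le (q.edist_le.trans ?_), hadj.symm⟩
      have hlen : q.length + 1 = p.length := by
        rw [← p.length_reverse, hrev, SimpleGraph.Walk.length_cons]
      rw [← hp, ← hlen] at h
      exact_mod_cast Nat.le_of_succ_le_succ (by exact_mod_cast h)
  · rintro (h | ⟨y, hxy, hyz⟩)
    · exact h.trans (by exact_mod_cast n.le_succ)
    · rw [Nat.cast_succ]
      exact SimpleGraph.edist_triangle.trans
        (add_le_add hxy (SimpleGraph.edist_eq_one_iff_adj.2 hyz).le)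

lemma edist_le_add (hxy : Γ.edist x y ≤ m) (hyz : Γ.edist y z ≤ n) :
    Γ.edist x z ≤ (m + n : ℕ) := by
  rw [Nat.cast_add]
  exact SimpleGraph.edist_triangle.trans (add_le_add hxy hyz)

lemma edist_le_mono (hmn : m ≤ n) (h : Γ.edist x y ≤ m) : Γ.edist x y ≤ n :=
  h.trans (by exact_mod_cast hmn)

lemma edist_le_symm (h : Γ.edist x y ≤ n) : Γ.edist y x ≤ n :=
  SimpleGraph.edist_comm.trans_le h

lemma exists_edist_le_of_edist_le_add (h : Γ.edist x z ≤ (m + n : ℕ)) :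
    ∃ y, Γ.edist x y ≤ m ∧ Γ.edist y z ≤ n := by
  induction n generalizing z with
  | zero => exact ⟨z, h, by simp⟩
  | succ n ih =>
    obtain h | ⟨w, hxw, hwz⟩ := edist_le_succ_iff.1 h
    · obtain ⟨y, hxy, hyz⟩ := ih h
      exact ⟨y, hxy, edist_le_mono n.le_succ hyz⟩
    · obtain ⟨y, hxy, hyw⟩ := ih hxw
      exact ⟨y, hxy, edist_le_succ_iff.2 (.inr ⟨w, hyw, hwz⟩)⟩

lemma edist_le_iff_of_adj_iff (hadj : ∀ y, H.edist x y ≤ m → ∀ z, Γ.Adj y z ↔ H.Adj y z)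
    (hn : n ≤ m + 1) : Γ.edist x z ≤ n ↔ H.edist x z ≤ n := by
  induction n generalizing z with
  | zero => simp
  | succ n ih =>
    simp only [edist_le_succ_iff, ih (Nat.le_of_succ_le hn)]
    exact or_congr_right (exists_congr fun y ↦ and_congr_right fun hy ↦
      hadj y (edist_le_mono (Nat.le_of_succ_le_succ hn) hy) z)

lemma edist_le_one (h : Γ.Adj x y) (hn : 1 ≤ n) : Γ.edist x y ≤ n :=
  (SimpleGraph.edist_eq_one_iff_adj.2 h).trans_le (by exact_mod_cast hn)

lemma mem_of_edist_le {K : Set W} (hK : ∀ a ∈ K, ∀ b, Γ.Adj a b → b ∈ K) (hx : x ∈ K)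
    (h : Γ.edist x y ≤ n) : y ∈ K := by
  induction n generalizing y with
  | zero =>
    obtain rfl : x = y := by simpa using h
    exact hx
  | succ n ih =>
    obtain h | ⟨z, hxz, hzy⟩ := edist_le_succ_iff.1 h
    exacts [ih h, hK z (ih hxz) y hzy]

/-- The vertices at distance less than `n` from the set `A`. -/
def thickening (Γ : SimpleGraph W) (A : Set W) (n : ℕ) : Set W := {z | ∃ w ∈ A, Γ.edist w z < n}

/-- The vertices at distance at most `n` from the set `A`. -/
def cthickening (Γ : SimpleGraph W) (A : Set W) (n : ℕ) : Set W := {z | ∃ w ∈ A, Γ.edist w z ≤ n}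

variable {A : Set W}

lemma thickening_zero : thickening Γ A 0 = ∅ := by simp [thickening]

lemma thickening_succ : thickening Γ A (n + 1) = cthickening Γ A n := by
  simp [thickening, cthickening, ENat.lt_add_one_iff]

lemma cthickening_mono (hmn : m ≤ n) : cthickening Γ A m ⊆ cthickening Γ A n :=
  fun _ ⟨w, hw, hwz⟩ ↦ ⟨w, hw, edist_le_mono hmn hwz⟩

lemma thickening_subset_cthickening : thickening Γ A n ⊆ cthickening Γ A n :=
  fun _ ⟨w, hw, hwz⟩ ↦ ⟨w, hw, hwz.le⟩

lemma subset_cthickening : A ⊆ cthickening Γ A n := fun a ha ↦ ⟨a, ha, by simp⟩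

lemma mem_cthickening_succ_iff :
    z ∈ cthickening Γ A (n + 1) ↔
      z ∈ cthickening Γ A n ∨ ∃ y ∈ cthickening Γ A n, Γ.Adj y z := by
  simp only [cthickening, Set.mem_ofPred_eq, edist_le_succ_iff]
  aesop

lemma mem_cthickening_of_mem_thickening_of_adj (hy : y ∈ thickening Γ A n) (hyz : Γ.Adj y z) :
    z ∈ cthickening Γ A n := by
  cases n with
  | zero => simp [thickening_zero] at hy
  | succ n => exact mem_cthickening_succ_iff.2 (.inr ⟨y, thickening_succ ▸ hy, hyz⟩)

lemma thickening_congr (h : ∀ m < n, cthickening Γ A m = cthickening H A m) :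
    thickening Γ A n = thickening H A n := by
  cases n with
  | zero => simp only [thickening_zero]
  | succ n => simpa only [thickening_succ] using h n n.lt_succ_self

/-- Two vertices of `L` are linked if one can go from one to the other by jumping between vertices
of `L` at distance at most `d`. -/
def Linked (Γ : SimpleGraph W) (L : Set W) (d : ℕ) : W → W → Prop :=
  Relation.TransGen fun a b ↦ a ∈ L ∧ b ∈ L ∧ Γ.edist a b ≤ d

/-- The vertices linked to `w`: an equivalence class of linked vertices if `w ∈ L`, and `∅`
otherwise. -/
def cluster (Γ : SimpleGraph W) (L : Set W) (d : ℕ) (w : W) : Set W := {a | Linked Γ L d w a}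

/-- The union of the clusters, for jumps of length at most `2 * r`, that meet the ball of radius `r`
around `x`. -/
def clustersNear (Γ : SimpleGraph W) (L : Set W) (r : ℕ) (x : W) : Set W :=
  {w | ∃ w₀ ∈ L, Γ.edist w₀ x ≤ r ∧ Linked Γ L (2 * r) w₀ w}

namespace Linked

variable {L : Set W} {d : ℕ} {a b c : W}

lemma of_edist_le (ha : a ∈ L) (hb : b ∈ L) (h : Γ.edist a b ≤ d) : Linked Γ L d a b :=
  .single ⟨ha, hb, h⟩

lemma refl (ha : a ∈ L) : Linked Γ L d a a := of_edist_le ha ha (by simp)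

lemma symm (h : Linked Γ L d a b) : Linked Γ L d b a :=
  Relation.TransGen.mono (fun _ _ ⟨ha, hb, hab⟩ ↦ ⟨hb, ha, edist_le_symm hab⟩) _ _
    (Relation.TransGen.swap _ _ h)

lemma trans (hab : Linked Γ L d a b) (hbc : Linked Γ L d b c) : Linked Γ L d a c :=
  Relation.TransGen.trans hab hbc

lemma right_mem (h : Linked Γ L d a b) : b ∈ L := by
  cases h with
  | single h => exact h.2.1
  | tail _ h => exact h.2.1

lemma left_mem (h : Linked Γ L d a b) : a ∈ L := h.symm.right_mem

lemma of_mem_cthickening (hmn : m + n ≤ d) (ha : z ∈ cthickening Γ (cluster Γ L d a) m)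
    (hb : z ∈ cthickening Γ (cluster Γ L d b) n) : Linked Γ L d a b := by
  obtain ⟨u, hau, huz⟩ := ha
  obtain ⟨v, hbv, hvz⟩ := hb
  have huv : Linked Γ L d u v := .of_edist_le hau.right_mem hbv.right_mem
    (edist_le_mono hmn (edist_le_add huz (edist_le_symm hvz)))
  exact (Linked.trans hau huv).trans hbv.symm

lemma of_mem_cthickening_of_mem (hn : n ≤ d) (hz : z ∈ cthickening Γ (cluster Γ L d a) n)
    (hzL : z ∈ L) : Linked Γ L d a z :=
  of_mem_cthickening (n := 0) hn hz (subset_cthickening (refl hzL))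

lemma cluster_eq (h : Linked Γ L d a b) : cluster Γ L d a = cluster Γ L d b :=
  Set.ext fun _ ↦ ⟨h.symm.trans, h.trans⟩

end Linked

end Distance

section Induced

variable {W : Type*} {Γ : SimpleGraph W} {p : ℕ → W}

/-- The vertices `p s` with `s ∈ S` induce a copy of the subgraph induced by `S` of the infinite
path `0, 1, 2, …`. An induced path on `N` vertices is the case `S = Set.Iio N`. -/
structure IsInducedOn (Γ : SimpleGraph W) (S : Set ℕ) (p : ℕ → W) : Prop where
  injOn : Set.InjOn p S
  adj_iff : ∀ s ∈ S, ∀ t ∈ S, Γ.Adj (p s) (p t) ↔ s + 1 = t ∨ t + 1 = s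

namespace IsInducedOn

lemma mono {S T : Set ℕ} (hp : IsInducedOn Γ T p) (hST : S ⊆ T) : IsInducedOn Γ S p :=
  ⟨hp.injOn.mono hST, fun s hs t ht ↦ hp.adj_iff s (hST hs) t (hST ht)⟩

lemma congr {H : SimpleGraph W} {S : Set ℕ} (hp : IsInducedOn H S p)
    (hadj : ∀ s ∈ S, ∀ t ∈ S, Γ.Adj (p s) (p t) ↔ H.Adj (p s) (p t)) : IsInducedOn Γ S p :=
  ⟨hp.injOn, fun s hs t ht ↦ (hadj s hs t ht).trans (hp.adj_iff s hs t ht)⟩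

variable {N : ℕ}

lemma adj_succ (hp : IsInducedOn Γ (Set.Iio N) p) {s : ℕ} (hs : s + 1 < N) :
    Γ.Adj (p s) (p (s + 1)) :=
  (hp.adj_iff s (Nat.lt_of_succ_lt hs) (s + 1) hs).2 (.inl rfl)

lemma mem_support (hp : IsInducedOn Γ (Set.Iio N) p) (hN : 2 ≤ N) {s : ℕ} (hs : s < N) :
    p s ∈ Γ.support := by
  rw [SimpleGraph.mem_support]
  cases s with
  | zero => exact ⟨p 1, hp.adj_succ hN⟩
  | succ s => exact ⟨p s, (hp.adj_succ hs).symm⟩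

lemma edist_le (hp : IsInducedOn Γ (Set.Iio N) p) {s : ℕ} (d : ℕ) (hs : s + d < N) :
    Γ.edist (p s) (p (s + d)) ≤ d := by
  induction d with
  | zero => simp
  | succ d ih =>
    exact edist_le_succ_iff.2 (.inr ⟨_, ih (Nat.lt_of_succ_lt hs), hp.adj_succ hs⟩)

end IsInducedOn

end Induced

section Patterns

/-- The combinatorial data of a part of an induced path that stays close to one cluster: the
positions `support` of its vertices on the path, two distinguished positions `fst` and `snd`, and
the distance `level` to the cluster below which all the other positions lie. -/
structure Pattern where
  level : ℕ
  support : Finset ℕ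
  fst : ℕ
  snd : ℕ
deriving DecidableEq

/-- The patterns of level at most `r` for paths on `N` vertices. -/
def patterns (r N : ℕ) : Finset Pattern :=
  (Finset.range (r + 1) ×ˢ (Finset.range N).powerset ×ˢ Finset.range N ×ˢ Finset.range N).image
    fun ⟨h, S, i, j⟩ ↦ ⟨h, S, i, j⟩

lemma mem_patterns {r N : ℕ} {π : Pattern} :
    π ∈ patterns r N ↔ π.level ≤ r ∧ π.support ⊆ Finset.range N ∧ π.fst < N ∧ π.snd < N := by
  obtain ⟨h, S, i, j⟩ := π
  simp [patterns]

/-- The pattern `π` occurs in `Γ` around the clusters near `x`, with `x` and `u` at its two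
distinguished positions. -/
def Realizes {W : Type*} (Γ : SimpleGraph W) (L : Set W) (r : ℕ) (x u : W) (π : Pattern) : Prop :=
  x ∈ Γ.support ∧ u ∈ Γ.support ∧ ∃ ρ : ℕ → W, ρ π.fst = x ∧ ρ π.snd = u ∧
    (∀ s ∈ π.support, s ≠ π.fst → s ≠ π.snd →
      ρ s ∈ thickening Γ (clustersNear Γ L r x) π.level) ∧
    IsInducedOn Γ π.support ρ

end Patterns

/-- Each vertex `v` of a union `K` of components of `H` believes that the graph is `Γ v`. The
beliefs agree with each other and with `H` as far as a local verification of radius `r + 1` can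
enforce it: the rows of `H` outside the set `L` of vertices of large degree, the way `L` splits into
clusters and the patterns with a single distinguished vertex are common knowledge, everything is
shared within distance `r` of `L`, and the other patterns are shared within distance `r + 1`. -/
structure Beliefs {W : Type*} (H : SimpleGraph W) (L K : Set W) (r N : ℕ)
    (Γ : W → SimpleGraph W) : Prop where
  closed : ∀ a ∈ K, ∀ b, H.Adj a b → b ∈ K
  adj_self : ∀ v ∈ K, ∀ b, (Γ v).Adj v b ↔ H.Adj v b
  low : ∀ v ∈ K, ∀ v' ∈ K, ∀ a ∉ L, ∀ b, (Γ v).Adj a b ↔ (Γ v').Adj a b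
  eq_of_edist_le : ∀ v ∈ K, ∀ w ∈ L, H.edist w v ≤ r → Γ v = Γ w
  linked : ∀ v ∈ K, ∀ v' ∈ K, ∀ w ∈ L, ∀ w' ∈ L,
    Linked (Γ v) L (2 * r) w w' ↔ Linked (Γ v') L (2 * r) w w'
  loops : ∀ v ∈ K, ∀ v' ∈ K, ∀ x, ∀ π ∈ patterns r N,
    Realizes (Γ v) L r x x π ↔ Realizes (Γ v') L r x x π
  table : ∀ v ∈ K, ∀ x ∈ K, H.edist v x ≤ (r + 1 : ℕ) → ∀ u, ∀ π ∈ patterns r N,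
    Realizes (Γ v) L r x u π ↔ Realizes (Γ x) L r x u π
  free : ∀ v ∈ K, ¬ ∃ p, IsInducedOn (Γ v) (Set.Iio N) p

namespace Beliefs

variable {W : Type*} {H : SimpleGraph W} {L K : Set W} {r N : ℕ} {Γ : W → SimpleGraph W}
  {v w x z a b : W}

lemma mem_of_edist_le (B : Beliefs H L K r N Γ) {n : ℕ} (ha : a ∈ K) (h : H.edist a b ≤ n) :
    b ∈ K :=
  _root_.mem_of_edist_le B.closed ha h

lemma eq_of_linked (B : Beliefs H L K r N Γ) (hw : w ∈ K) (h : Linked H L (2 * r) w z) :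
    z ∈ K ∧ Γ w = Γ z := by
  have hjump {a b : W} (haK : a ∈ K) (h : a ∈ L ∧ b ∈ L ∧ H.edist a b ≤ (2 * r : ℕ)) :
      b ∈ K ∧ Γ a = Γ b := by
    obtain ⟨ha, hb, hab⟩ := h
    obtain ⟨m, ham, hmb⟩ := exists_edist_le_of_edist_le_add (two_mul r ▸ hab)
    have hm := B.mem_of_edist_le haK ham
    exact ⟨B.mem_of_edist_le hm hmb,
      (B.eq_of_edist_le m hm a ha ham).symm.trans (B.eq_of_edist_le m hm b hb (edist_le_symm hmb))⟩
  induction h with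
  | single h => exact hjump hw h
  | tail _ h ih => exact ⟨(hjump ih.1 h).1, ih.2.trans (hjump ih.1 h).2⟩

lemma low_adj (B : Beliefs H L K r N Γ) (hv : v ∈ K) (ha : a ∈ K) (h : a ∉ L ∨ b ∉ L) :
    (Γ v).Adj a b ↔ H.Adj a b := by
  obtain haL | hbL := h
  · rw [B.low v hv a ha a haL, B.adj_self a ha]
  · rw [SimpleGraph.adj_comm, B.low v hv a ha b hbL, SimpleGraph.adj_comm, B.adj_self a ha]

lemma adj_iff_of_linked (B : Beliefs H L K r N Γ) (hw : w ∈ K) (h : Linked H L (2 * r) w a) :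
    (Γ w).Adj a b ↔ H.Adj a b := by
  obtain ⟨ha, hΓ⟩ := B.eq_of_linked hw h
  rw [hΓ, B.adj_self a ha]

lemma edist_le_iff (B : Beliefs H L K r N Γ) (hw : w ∈ K) (hL : w ∈ L) {n : ℕ}
    (hn : n ≤ 2 * r + 1) : (Γ w).edist w z ≤ n ↔ H.edist w z ≤ n := by
  refine edist_le_iff_of_adj_iff (fun y hy b ↦ ?_) hn
  by_cases hyL : y ∈ L
  · exact B.adj_iff_of_linked hw (.of_edist_le hL hyL hy)
  · exact B.low_adj hw (B.mem_of_edist_le hw hy) (.inl hyL)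

lemma linked_self_iff (B : Beliefs H L K r N Γ) (hw : w ∈ K) :
    Linked (Γ w) L (2 * r) w z ↔ Linked H L (2 * r) w z := by
  have hjump {a b : W} (ha : a ∈ K ∧ Γ w = Γ a) :
      (a ∈ L ∧ b ∈ L ∧ (Γ w).edist a b ≤ (2 * r : ℕ)) ↔
        a ∈ L ∧ b ∈ L ∧ H.edist a b ≤ (2 * r : ℕ) := by
    refine and_congr_right fun haL ↦ and_congr_right fun _ ↦ ?_
    rw [ha.2, B.edist_le_iff ha.1 haL (Nat.le_succ _)]
  constructor
  · intro h
    induction h with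
    | single h => exact .single ((hjump ⟨hw, rfl⟩).1 h)
    | tail _ h ih => exact .tail ih ((hjump (B.eq_of_linked hw ih)).1 h)
  · intro h
    induction h with
    | single h => exact .single ((hjump ⟨hw, rfl⟩).2 h)
    | tail hwa h ih => exact .tail ih ((hjump (B.eq_of_linked hw hwa)).2 h)

lemma linked_iff (B : Beliefs H L K r N Γ) (hv : v ∈ K) (hw : w ∈ K) :
    Linked (Γ v) L (2 * r) w z ↔ Linked H L (2 * r) w z := by
  rw [← B.linked_self_iff hw]
  constructor <;> intro h
  · exact (B.linked v hv w hw w h.left_mem z h.right_mem).1 h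
  · exact (B.linked v hv w hw w h.left_mem z h.right_mem).2 h

lemma adj_or_linked (B : Beliefs H L K r N Γ) (hr : 1 ≤ r) (hv : v ∈ K) (ha : a ∈ K)
    (h : (Γ v).Adj a b) : H.Adj a b ∨ Linked H L (2 * r) a b := by
  by_cases hL : a ∈ L ∧ b ∈ L
  · exact .inr ((B.linked_iff hv ha).1 (.of_edist_le hL.1 hL.2 (edist_le_one h (by omega))))
  · exact .inl ((B.low_adj hv ha (not_and_or.1 hL)).1 h)

lemma mem_of_edist_le_belief (B : Beliefs H L K r N Γ) (hr : 1 ≤ r) (hv : v ∈ K) {n : ℕ}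
    (ha : a ∈ K) (h : (Γ v).edist a b ≤ n) : b ∈ K :=
  _root_.mem_of_edist_le (fun _ hz _ hadj ↦ (B.adj_or_linked hr hv hz hadj).elim
    (B.closed _ hz _) fun hlinked ↦ (B.eq_of_linked hz hlinked).1) ha h

lemma mem_of_mem_cthickening (B : Beliefs H L K r N Γ) (hw : w ∈ K) {n : ℕ}
    (hz : z ∈ cthickening H (cluster H L (2 * r) w) n) : z ∈ K := by
  obtain ⟨a, ha, haz⟩ := hz
  exact B.mem_of_edist_le (B.eq_of_linked hw ha).1 haz

lemma cthickening_eq (B : Beliefs H L K r N Γ) (hr : 1 ≤ r) (hv : v ∈ K) (hw : w ∈ K) {n : ℕ}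
    (hn : n ≤ 2 * r) : cthickening (Γ v) (cluster H L (2 * r) w) n =
      cthickening H (cluster H L (2 * r) w) n := by
  induction n with
  | zero => simp [cthickening]
  | succ n ih =>
    ext z
    rw [mem_cthickening_succ_iff, mem_cthickening_succ_iff, ih (Nat.le_of_succ_le hn),
      ← mem_cthickening_succ_iff, mem_cthickening_succ_iff]
    refine or_congr_right' fun hz ↦ exists_congr fun y ↦ and_congr_right fun hy ↦ ?_
    have hyK := B.mem_of_mem_cthickening hw hy
    by_cases hL : y ∈ L ∧ z ∈ L
    · have hnot : ¬ Linked H L (2 * r) y z := fun h ↦ hz (subset_cthickening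
        ((Linked.of_mem_cthickening_of_mem (Nat.le_of_succ_le hn) hy hL.1).trans h))
      have hdist {G : SimpleGraph W} (h : G.Adj y z) : Linked G L (2 * r) y z :=
        .of_edist_le hL.1 hL.2 (edist_le_one h (by omega))
      exact iff_of_false (fun h ↦ hnot ((B.linked_iff hv hyK).1 (hdist h))) (fun h ↦ hnot (hdist h))
    · exact B.low_adj hv hyK (not_and_or.1 hL)

lemma thickening_eq (B : Beliefs H L K r N Γ) (hr : 1 ≤ r) (hv : v ∈ K) (hw : w ∈ K) {n : ℕ}
    (hn : n ≤ 2 * r) : thickening (Γ v) (cluster H L (2 * r) w) n =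
      thickening H (cluster H L (2 * r) w) n :=
  thickening_congr fun _ hm ↦ B.cthickening_eq hr hv hw (hm.le.trans hn)

lemma clustersNear_eq (B : Beliefs H L K r N Γ) (hr : 1 ≤ r) (hv : v ∈ K) (hw : w ∈ K)
    (hx : x ∈ cthickening H (cluster H L (2 * r) w) r) :
    clustersNear (Γ v) L r x = cluster H L (2 * r) w := by
  have hr2 : r ≤ 2 * r := by omega
  ext a
  constructor
  · rintro ⟨w₀, hw₀, hw₀x, hlinked⟩
    have hw₀K : w₀ ∈ K := B.mem_of_edist_le_belief hr hv (B.mem_of_mem_cthickening hw hx)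
      (edist_le_symm hw₀x)
    have hx₀ : x ∈ cthickening H (cluster H L (2 * r) w₀) r :=
      B.cthickening_eq hr hv hw₀K hr2 ▸ ⟨w₀, .refl hw₀, hw₀x⟩
    exact (Linked.of_mem_cthickening (two_mul r).ge hx hx₀).trans ((B.linked_iff hv hw₀K).1 hlinked)
  · intro ha
    rw [← B.cthickening_eq hr hv hw hr2] at hx
    obtain ⟨w₀, hw₀, hw₀x⟩ := hx
    exact ⟨w₀, hw₀.right_mem, hw₀x,
      (B.linked_iff hv (B.eq_of_linked hw hw₀).1).2 (hw₀.symm.trans ha)⟩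

lemma eq_of_mem_cthickening (B : Beliefs H L K r N Γ) (hw : w ∈ K)
    (hx : x ∈ cthickening H (cluster H L (2 * r) w) r) : Γ x = Γ w := by
  have hxK := B.mem_of_mem_cthickening hw hx
  obtain ⟨a, ha, hax⟩ := hx
  rw [B.eq_of_edist_le x hxK a ha.right_mem hax, (B.eq_of_linked hw ha).2]

lemma realizes_of_path (B : Beliefs H L K r N Γ) (hr : 1 ≤ r) {p : ℕ → W}
    (hpK : ∀ s < N, p s ∈ K) (hp : IsInducedOn H (Set.Iio N) p) (hN : 2 ≤ N) (hw : w ∈ K)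
    {π : Pattern} (hπ : π ∈ patterns r N) (hfst : π.fst ∈ π.support) (hsnd : π.snd ∈ π.support)
    (hnear : ∀ s ∈ π.support, p s ∈ cthickening H (cluster H L (2 * r) w) π.level)
    (hinner : ∀ s ∈ π.support, s ≠ π.fst → s ≠ π.snd →
      p s ∈ thickening H (cluster H L (2 * r) w) π.level) :
    Realizes (Γ (p π.fst)) L r (p π.fst) (p π.snd) π := by
  obtain ⟨hlevel, hsub, hfstN, -⟩ := mem_patterns.1 hπ
  have hlt : ∀ s ∈ π.support, s < N := fun s hs ↦ Finset.mem_range.1 (hsub hs)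
  have hvK := hpK π.fst hfstN
  have hfstnear := cthickening_mono hlevel (hnear _ hfst)
  have hadj : ∀ s ∈ π.support, ∀ b, (Γ (p π.fst)).Adj (p s) b ↔ H.Adj (p s) b := by
    intro s hs b
    by_cases hL : p s ∈ L
    · rw [B.eq_of_mem_cthickening hw hfstnear]
      exact B.adj_iff_of_linked hw (.of_mem_cthickening_of_mem (by omega) (hnear s hs) hL)
    · exact B.low_adj hvK (hpK s (hlt s hs)) (.inl hL)
  have hsupport : ∀ s ∈ π.support, p s ∈ (Γ (p π.fst)).support := by
    intro s hs
    obtain ⟨b, hb⟩ := hp.mem_support hN (hlt s hs)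
    exact ⟨b, (hadj s hs b).2 hb⟩
  refine ⟨hsupport _ hfst, hsupport _ hsnd, p, rfl, rfl, fun s hs h₁ h₂ ↦ ?_,
    (hp.mono hlt).congr fun s hs t _ ↦ hadj s hs _⟩
  rw [B.clustersNear_eq hr hvK hw hfstnear, B.thickening_eq hr hvK hw (by omega)]
  exact hinner s hs h₁ h₂

end Beliefs

section Gluing

variable {W ι : Type*} {Γ H : SimpleGraph W} {N : ℕ} {p : ℕ → W}

/-- The path `ρ` is a detour in `Γ` for the part of `p` inside `C`: it only moves vertices of `U`,
moves them inside `U`, and its part that replaces the vertices of `p` in `C` is induced in `Γ`. -/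
structure IsDetour (Γ : SimpleGraph W) (U C : Set W) (N : ℕ) (p ρ : ℕ → W) : Prop where
  eq_of_notMem : ∀ s < N, p s ∈ C → p s ∉ U → ρ s = p s
  mem_of_mem : ∀ s < N, p s ∈ U → ρ s ∈ U
  isInducedOn : IsInducedOn Γ {s | s < N ∧ p s ∈ C} ρ

/-- Detours for the path `p` of `H` that can be followed simultaneously: the regions `C i` are
disjoint and contain the neighbours, in both graphs, of the sets `U i` where `p` is changed. -/
structure AreSeparatedDetours (H Γ : SimpleGraph W) (U C : ι → Set W) (N : ℕ) (p : ℕ → W)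
    (ρ : ι → ℕ → W) : Prop where
  subset : ∀ i, U i ⊆ C i
  eq_of_mem : ∀ i j, ∀ y ∈ C i, y ∈ C j → i = j
  mem_of_adj : ∀ i, ∀ y ∈ U i, ∀ z, H.Adj y z ∨ Γ.Adj y z → z ∈ C i
  isDetour : ∀ i, IsDetour Γ (U i) (C i) N p (ρ i)

open Classical in
/-- The path that follows the detour `ρ i` inside `U i`, for all `i`, and `p` elsewhere. -/
noncomputable def followDetours (U : ι → Set W) (p : ℕ → W) (ρ : ι → ℕ → W) (s : ℕ) : W :=
  if h : ∃ i, p s ∈ U i then ρ h.choose s else p s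

lemma followDetours_of_notMem {U : ι → Set W} {ρ : ι → ℕ → W} {s : ℕ} (hs : ∀ i, p s ∉ U i) :
    followDetours U p ρ s = p s :=
  dif_neg (not_exists.2 hs)

namespace AreSeparatedDetours

variable {U C : ι → Set W} {ρ : ι → ℕ → W} {i : ι} {s t : ℕ}

lemma followDetours_of_mem_inner (D : AreSeparatedDetours H Γ U C N p ρ) (hs : p s ∈ U i) :
    followDetours U p ρ s = ρ i s := by
  have h : ∃ i, p s ∈ U i := ⟨i, hs⟩
  rw [followDetours, dif_pos h,
    D.eq_of_mem _ i _ (D.subset _ h.choose_spec) (D.subset i hs)]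

lemma followDetours_of_mem (D : AreSeparatedDetours H Γ U C N p ρ) (hsN : s < N)
    (hs : p s ∈ C i) : followDetours U p ρ s = ρ i s := by
  by_cases hU : p s ∈ U i
  · exact D.followDetours_of_mem_inner hU
  rw [followDetours_of_notMem, (D.isDetour i).eq_of_notMem s hsN hs hU]
  intro j hj
  obtain rfl := D.eq_of_mem i j _ hs (D.subset j hj)
  exact hU hj

lemma followDetours_mem_inner (D : AreSeparatedDetours H Γ U C N p ρ) (hsN : s < N)
    (hs : p s ∈ U i) : followDetours U p ρ s ∈ U i := by
  rw [D.followDetours_of_mem_inner hs]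
  exact (D.isDetour i).mem_of_mem s hsN hs

lemma mem_of_followDetours_mem (D : AreSeparatedDetours H Γ U C N p ρ) (hsN : s < N)
    (hs : followDetours U p ρ s ∈ C i) : p s ∈ C i := by
  by_cases h : ∃ j, p s ∈ U j
  · obtain ⟨j, hj⟩ := h
    obtain rfl := D.eq_of_mem i j _ hs (D.subset j (D.followDetours_mem_inner hsN hj))
    exact D.subset i hj
  · rwa [followDetours_of_notMem (not_exists.1 h)] at hs

lemma separated (D : AreSeparatedDetours H Γ U C N p ρ) (hp : IsInducedOn H (Set.Iio N) p)
    (hsN : s < N) (htN : t < N) (hs : p s ∈ U i) (ht : p t ∉ C i) :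
    followDetours U p ρ s ≠ followDetours U p ρ t ∧
      ¬ Γ.Adj (followDetours U p ρ s) (followDetours U p ρ t) ∧ ¬ (s + 1 = t ∨ t + 1 = s) := by
  have hs' := D.followDetours_mem_inner hsN hs
  have ht' := mt (D.mem_of_followDetours_mem htN) ht
  exact ⟨fun h ↦ ht' (h ▸ D.subset i hs'), fun h ↦ ht' (D.mem_of_adj i _ hs' _ (.inr h)),
    fun h ↦ ht (D.mem_of_adj i _ hs _ (.inl ((hp.adj_iff s hsN t htN).2 h)))⟩

theorem isInducedOn_followDetours (D : AreSeparatedDetours H Γ U C N p ρ)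
    (hp : IsInducedOn H (Set.Iio N) p)
    (hadj : ∀ s < N, ∀ t < N, (∀ i, p s ∈ C i → p t ∉ C i) →
      (Γ.Adj (p s) (p t) ↔ H.Adj (p s) (p t))) :
    IsInducedOn Γ (Set.Iio N) (followDetours U p ρ) := by
  have hpair : ∀ s < N, ∀ t < N,
      (followDetours U p ρ s = followDetours U p ρ t → s = t) ∧
      (Γ.Adj (followDetours U p ρ s) (followDetours U p ρ t) ↔ s + 1 = t ∨ t + 1 = s) := by
    intro s hs t ht
    by_cases hC : ∃ i, p s ∈ C i ∧ p t ∈ C i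
    · obtain ⟨i, hsi, hti⟩ := hC
      rw [D.followDetours_of_mem hs hsi, D.followDetours_of_mem ht hti]
      exact ⟨fun h ↦ (D.isDetour i).isInducedOn.injOn ⟨hs, hsi⟩ ⟨ht, hti⟩ h,
        (D.isDetour i).isInducedOn.adj_iff s ⟨hs, hsi⟩ t ⟨ht, hti⟩⟩
    push Not at hC
    by_cases hsU : ∃ i, p s ∈ U i
    · obtain ⟨i, hi⟩ := hsU
      obtain ⟨hne, hnadj, hnsucc⟩ := D.separated hp hs ht hi (hC i (D.subset i hi))
      exact ⟨fun h ↦ absurd h hne, iff_of_false hnadj hnsucc⟩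
    by_cases htU : ∃ i, p t ∈ U i
    · obtain ⟨i, hi⟩ := htU
      obtain ⟨hne, hnadj, hnsucc⟩ :=
        D.separated hp ht hs hi fun hsi ↦ hC i hsi (D.subset i hi)
      exact ⟨fun h ↦ absurd h.symm hne,
        iff_of_false (fun h ↦ hnadj h.symm) (fun h ↦ hnsucc h.symm)⟩
    rw [followDetours_of_notMem (not_exists.1 hsU), followDetours_of_notMem (not_exists.1 htU),
      hadj s hs t ht hC]
    exact ⟨fun h ↦ hp.injOn hs ht h, hp.adj_iff s hs t ht⟩
  exact ⟨fun s hs t ht ↦ (hpair s hs t ht).1, fun s hs t ht ↦ (hpair s hs t ht).2⟩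

end AreSeparatedDetours

end Gluing

/-- Some detour in `Γ` replaces the part of the path `p` of `H` that is close to `A`. -/
def HasDetour {W : Type*} (H Γ : SimpleGraph W) (A : Set W) (r N : ℕ) (p : ℕ → W) : Prop :=
  ∃ h ≤ r, ∃ ρ, IsDetour Γ (thickening H A h) (cthickening H A h) N p ρ

section Path

variable {W : Type*} {H : SimpleGraph W} {L K : Set W} {r N : ℕ} {Γ : W → SimpleGraph W}
  {w : W} {p : ℕ → W}

lemma Beliefs.adj_iff_of_not_linked (B : Beliefs H L K r N Γ) (hr : 1 ≤ r) {v a b : W}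
    (hv : v ∈ K) (ha : a ∈ K) (h : ¬ Linked H L (2 * r) a b) : (Γ v).Adj a b ↔ H.Adj a b := by
  refine ⟨fun hadj ↦ (B.adj_or_linked hr hv ha hadj).resolve_right h, fun hadj ↦ ?_⟩
  refine (B.low_adj hv ha (not_and_or.1 fun hL ↦ h ?_)).2 hadj
  exact .of_edist_le hL.1 hL.2 (edist_le_one hadj (by omega))

theorem Beliefs.exists_unlinked_not_hasDetour (B : Beliefs H L K r N Γ) (hr : 1 ≤ r)
    (hpK : ∀ s < N, p s ∈ K) (hp : IsInducedOn H (Set.Iio N) p) (hwK : w ∈ K) :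
    ∃ s < N, p s ∈ L ∧ ¬ Linked H L (2 * r) w (p s) ∧
      ¬ HasDetour H (Γ w) (cluster H L (2 * r) (p s)) r N p := by
  by_contra! hdetour
  let clusters : Set (Set W) :=
    {A | ∃ s < N, p s ∈ L ∧ ¬ Linked H L (2 * r) w (p s) ∧ A = cluster H L (2 * r) (p s)}
  have hclusters (A : clusters) : HasDetour H (Γ w) A r N p := by
    obtain ⟨_, s, hs, hsL, hws, rfl⟩ := A
    exact hdetour s hs hsL hws
  choose h hhr ρ hρ using hclusters
  have D : AreSeparatedDetours H (Γ w) (fun A : clusters ↦ thickening H A (h A))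
      (fun A ↦ cthickening H A (h A)) N p ρ := by
    refine ⟨fun A ↦ thickening_subset_cthickening, ?_, ?_, hρ⟩
    · rintro ⟨_, s, _, _, _, rfl⟩ ⟨_, s', _, _, _, rfl⟩ y hy hy'
      exact Subtype.ext (Linked.of_mem_cthickening
        ((add_le_add (hhr _) (hhr _)).trans (two_mul r).ge) hy hy').cluster_eq
    · rintro ⟨_, s, hs, hsL, hws, rfl⟩ y hy z (hadj | hadj)
      · exact mem_cthickening_of_mem_thickening_of_adj hy hadj
      · have hle := (hhr ⟨_, s, hs, hsL, hws, rfl⟩).trans (by omega : r ≤ 2 * r)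
        rw [← B.thickening_eq hr hwK (hpK s hs) hle] at hy
        rw [← B.cthickening_eq hr hwK (hpK s hs) hle]
        exact mem_cthickening_of_mem_thickening_of_adj hy hadj
  refine B.free w hwK ⟨_, D.isInducedOn_followDetours hp fun s hs t _ hC ↦ ?_⟩
  by_cases hst : Linked H L (2 * r) (p s) (p t)
  · have hws : Linked H L (2 * r) w (p s) := by
      by_contra hws
      exact hC ⟨_, s, hs, hst.left_mem, hws, rfl⟩ (subset_cthickening (.refl hst.left_mem))
        (subset_cthickening hst)
    exact B.adj_iff_of_linked hwK hws
  · exact B.adj_iff_of_not_linked hr hwK (hpK s hs) hst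

/-- The distance in `H` from `p s` to the cluster of `p i`, or `0` if no vertex of this cluster can
be reached from `p s`. -/
noncomputable def clusterDist (H : SimpleGraph W) (L : Set W) (r : ℕ) (p : ℕ → W) (i s : ℕ) : ℕ :=
  sInf {n : ℕ | p s ∈ cthickening H (cluster H L (2 * r) (p i)) n}

/-- The pattern formed by the part of the path `p` at distance at most `h` from the cluster of
`p i`, with distinguished positions `a` and `b`. -/
noncomputable def clusterPattern (H : SimpleGraph W) (L : Set W) (r N : ℕ) (p : ℕ → W)
    (i h a b : ℕ) : Pattern :=
  ⟨h, {s ∈ Finset.range N | clusterDist H L r p i s ≤ h}, a, b⟩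

/-- The path `p` has at least two vertices at each distance at most `r` from the cluster of
`p i`. -/
def MeetsLevelsTwice (H : SimpleGraph W) (L : Set W) (r N : ℕ) (p : ℕ → W) (i : ℕ) : Prop :=
  ∀ h ≤ r, 2 ≤ #(levelSet N (clusterDist H L r p i) h)

variable {i i₁ i₂ i₃ s h a b : ℕ}

lemma mem_support_clusterPattern :
    s ∈ (clusterPattern H L r N p i h a b).support ↔ s < N ∧ clusterDist H L r p i s ≤ h := by
  simp [clusterPattern]

lemma mem_cthickening_iff_clusterDist_le (hp : IsInducedOn H (Set.Iio N) p) (hi : i < N)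
    (hiL : p i ∈ L) (hs : s < N) {n : ℕ} :
    p s ∈ cthickening H (cluster H L (2 * r) (p i)) n ↔ clusterDist H L r p i s ≤ n := by
  have hne : {n : ℕ | p s ∈ cthickening H (cluster H L (2 * r) (p i)) n}.Nonempty := by
    obtain ⟨d, rfl⟩ | ⟨d, rfl⟩ := (le_total i s).imp Nat.exists_eq_add_of_le
      Nat.exists_eq_add_of_le
    · exact ⟨d, p i, .refl hiL, hp.edist_le d hs⟩
    · exact ⟨d, _, .refl hiL, edist_le_symm (hp.edist_le d hi)⟩
  exact ⟨fun h ↦ Nat.sInf_le h, fun h ↦ cthickening_mono h (Nat.sInf_mem hne)⟩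

lemma mem_thickening_iff_clusterDist_lt (hp : IsInducedOn H (Set.Iio N) p) (hi : i < N)
    (hiL : p i ∈ L) (hs : s < N) {n : ℕ} :
    p s ∈ thickening H (cluster H L (2 * r) (p i)) n ↔ clusterDist H L r p i s < n := by
  cases n with
  | zero => simp [thickening_zero]
  | succ n =>
    rw [thickening_succ, mem_cthickening_iff_clusterDist_le hp hi hiL hs, Nat.lt_succ_iff]

lemma clusterDist_self (hiL : p i ∈ L) : clusterDist H L r p i i = 0 :=
  Nat.le_zero.1 (Nat.sInf_le (subset_cthickening (Linked.refl hiL)))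

lemma smallSteps_clusterDist (hp : IsInducedOn H (Set.Iio N) p) (hi : i < N) (hiL : p i ∈ L) :
    SmallSteps N (clusterDist H L r p i) := by
  intro s hs
  have hs' := Nat.lt_of_succ_lt hs
  have hadj := hp.adj_succ hs
  have hmem {s : ℕ} (hs : s < N) {n : ℕ} :=
    mem_cthickening_iff_clusterDist_le hp hi hiL (r := r) hs (n := n)
  constructor
  · exact (hmem hs).1 (mem_cthickening_succ_iff.2 (.inr ⟨_, (hmem hs').2 le_rfl, hadj⟩))
  · exact (hmem hs').1 (mem_cthickening_succ_iff.2 (.inr ⟨_, (hmem hs).2 le_rfl, hadj.symm⟩))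

lemma le_clusterDist_add_clusterDist (hp : IsInducedOn H (Set.Iio N) p) (h₁ : i₁ < N) (h₂ : i₂ < N)
    (hL₁ : p i₁ ∈ L) (hL₂ : p i₂ ∈ L) (h₁₂ : ¬ Linked H L (2 * r) (p i₁) (p i₂)) (hs : s < N) :
    2 * (r + 1) ≤ clusterDist H L r p i₁ s + clusterDist H L r p i₂ s + 1 := by
  by_contra! hlt
  exact h₁₂ (Linked.of_mem_cthickening (by omega)
    ((mem_cthickening_iff_clusterDist_le hp h₁ hL₁ hs).2 le_rfl)
    ((mem_cthickening_iff_clusterDist_le hp h₂ hL₂ hs).2 le_rfl))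

lemma MeetsLevelsTwice.le_card (h : MeetsLevelsTwice H L r N p i) :
    2 * (r + 1) ≤ #{s ∈ Finset.range N | clusterDist H L r p i s < r + 1} := by
  simpa using mul_sub_le_card_of_card_levelSet_ge (a := 0) (b := r + 1)
    fun x _ hx ↦ h x (Nat.lt_succ_iff.1 hx)

lemma le_of_three_meetsLevelsTwice (hp : IsInducedOn H (Set.Iio N) p)
    (h₁ : i₁ < N) (h₂ : i₂ < N) (h₃ : i₃ < N) (hL₁ : p i₁ ∈ L) (hL₂ : p i₂ ∈ L) (hL₃ : p i₃ ∈ L)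
    (h₁₂ : ¬ Linked H L (2 * r) (p i₁) (p i₂)) (h₁₃ : ¬ Linked H L (2 * r) (p i₁) (p i₃))
    (h₂₃ : ¬ Linked H L (2 * r) (p i₂) (p i₃)) (hm₁ : MeetsLevelsTwice H L r N p i₁)
    (hm₂ : MeetsLevelsTwice H L r N p i₂) (hm₃ : MeetsLevelsTwice H L r N p i₃) :
    6 * (r + 1) ≤ N := by
  have hfar₁₂ {s : ℕ} (hs : s ∈ Finset.range N) :=
    le_clusterDist_add_clusterDist hp h₁ h₂ hL₁ hL₂ h₁₂ (Finset.mem_range.1 hs)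
  have hfar₁₃ {s : ℕ} (hs : s ∈ Finset.range N) :=
    le_clusterDist_add_clusterDist hp h₁ h₃ hL₁ hL₃ h₁₃ (Finset.mem_range.1 hs)
  have hfar₂₃ {s : ℕ} (hs : s ∈ Finset.range N) :=
    le_clusterDist_add_clusterDist hp h₂ h₃ hL₂ hL₃ h₂₃ (Finset.mem_range.1 hs)
  have hpair := card_filter_add_card_filter_le (s := Finset.range N)
    (p := fun s ↦ clusterDist H L r p i₁ s < r + 1) (q := fun s ↦ clusterDist H L r p i₂ s < r + 1)
    (t := fun s ↦ clusterDist H L r p i₁ s < r + 1 ∨ clusterDist H L r p i₂ s < r + 1)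
    (fun _ _ ↦ .inl) (fun _ _ ↦ .inr) (fun s hs ↦ by have := hfar₁₂ hs; omega)
  have htriple := card_filter_add_card_filter_le (s := Finset.range N)
    (p := fun s ↦ clusterDist H L r p i₁ s < r + 1 ∨ clusterDist H L r p i₂ s < r + 1)
    (q := fun s ↦ clusterDist H L r p i₃ s < r + 1) (t := fun _ ↦ True)
    (fun _ _ _ ↦ trivial) (fun _ _ _ ↦ trivial)
    (fun s hs ↦ by have := hfar₁₃ hs; have := hfar₂₃ hs; omega)
  rw [Finset.filter_true, Finset.card_range] at htriple
  linarith [hm₁.le_card, hm₂.le_card, hm₃.le_card]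

namespace Beliefs

variable {v : W}

lemma realizes_clusterPattern (B : Beliefs H L K r N Γ) (hr : 1 ≤ r) (hpK : ∀ s < N, p s ∈ K)
    (hp : IsInducedOn H (Set.Iio N) p) (hN : 2 ≤ N) (hi : i < N) (hiL : p i ∈ L) (hh : h ≤ r)
    (hlevel : levelSet N (clusterDist H L r p i) h = {a, b}) :
    clusterPattern H L r N p i h a b ∈ patterns r N ∧
      Realizes (Γ (p a)) L r (p a) (p b) (clusterPattern H L r N p i h a b) := by
  have hmem : ∀ s, s < N ∧ clusterDist H L r p i s = h ↔ s = a ∨ s = b := fun s ↦ by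
    rw [← mem_levelSet, hlevel, Finset.mem_insert, Finset.mem_singleton]
  have ha := (hmem a).2 (.inl rfl)
  have hb := (hmem b).2 (.inr rfl)
  have hπ : clusterPattern H L r N p i h a b ∈ patterns r N :=
    mem_patterns.2 ⟨hh, Finset.filter_subset _ _, ha.1, hb.1⟩
  refine ⟨hπ, B.realizes_of_path hr hpK hp hN (hpK i hi) hπ
    (mem_support_clusterPattern.2 (ha.imp_right le_of_eq))
    (mem_support_clusterPattern.2 (hb.imp_right le_of_eq)) (fun s hs ↦ ?_)
    (fun s hs hsa hsb ↦ ?_)⟩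
  all_goals obtain ⟨hsN, hsh⟩ := mem_support_clusterPattern.1 hs
  · exact (mem_cthickening_iff_clusterDist_le hp hi hiL hsN).2 hsh
  · exact (mem_thickening_iff_clusterDist_lt hp hi hiL hsN).2
      (hsh.lt_of_ne fun heq ↦ ((hmem s).1 ⟨hsN, heq⟩).elim hsa hsb)

lemma hasDetour_of_realizes (B : Beliefs H L K r N Γ) (hr : 1 ≤ r) (hpK : ∀ s < N, p s ∈ K)
    (hp : IsInducedOn H (Set.Iio N) p) (hv : v ∈ K) (hi : i < N) (hiL : p i ∈ L) (hh : h ≤ r)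
    (hlevel : levelSet N (clusterDist H L r p i) h = {a, b})
    (hR : Realizes (Γ v) L r (p a) (p b) (clusterPattern H L r N p i h a b)) :
    HasDetour H (Γ v) (cluster H L (2 * r) (p i)) r N p := by
  have hmem : ∀ s, s < N ∧ clusterDist H L r p i s = h ↔ s = a ∨ s = b := fun s ↦ by
    rw [← mem_levelSet, hlevel, Finset.mem_insert, Finset.mem_singleton]
  have hle {s : ℕ} (hs : s < N) {n : ℕ} := mem_cthickening_iff_clusterDist_le hp hi hiL (r := r) hs
    (n := n)
  have hlt {s : ℕ} (hs : s < N) := mem_thickening_iff_clusterDist_lt hp hi hiL (r := r) hs (n := h)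
  obtain ⟨-, -, ρ, hρa, hρb, hρin, hρ⟩ := hR
  obtain ⟨haN, hah⟩ := (hmem a).2 (.inl rfl)
  have hclusters := B.clustersNear_eq hr hv (hpK i hi) ((hle haN).2 (hah.trans_le hh))
  have hthick := B.thickening_eq hr hv (hpK i hi) (hh.trans (by omega : r ≤ 2 * r))
  refine ⟨h, hh, ρ, fun s hs hsC hsU ↦ ?_, fun s hs hsU ↦ ?_,
    hρ.mono fun s ⟨hs, hsC⟩ ↦ ?_⟩
  · rw [hle hs] at hsC
    rw [hlt hs, not_lt] at hsU
    obtain rfl | rfl := (hmem s).1 ⟨hs, hsC.antisymm hsU⟩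
    exacts [hρa, hρb]
  · have hsh := (hlt hs).1 hsU
    have hsab := mt (hmem s).2 fun h' ↦ hsh.ne h'.2
    rw [← hthick, ← hclusters]
    exact hρin s (mem_support_clusterPattern.2 ⟨hs, hsh.le⟩) (not_or.1 hsab).1 (not_or.1 hsab).2
  · exact mem_support_clusterPattern.2 ⟨hs, (hle hs).1 hsC⟩

lemma hasDetour_of_card_levelSet_eq_one (B : Beliefs H L K r N Γ) (hr : 1 ≤ r)
    (hpK : ∀ s < N, p s ∈ K) (hp : IsInducedOn H (Set.Iio N) p) (hN : 2 ≤ N) (hv : v ∈ K)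
    (hi : i < N) (hiL : p i ∈ L) (hh : h ≤ r)
    (hcard : #(levelSet N (clusterDist H L r p i) h) = 1) :
    HasDetour H (Γ v) (cluster H L (2 * r) (p i)) r N p := by
  obtain ⟨a, ha⟩ := Finset.card_eq_one.1 hcard
  have haN := (mem_levelSet.1 (ha ▸ Finset.mem_singleton_self a)).1
  rw [← Finset.pair_eq_singleton] at ha
  obtain ⟨hπ, hR⟩ := B.realizes_clusterPattern hr hpK hp hN hi hiL hh ha
  exact B.hasDetour_of_realizes hr hpK hp hv hi hiL hh ha
    ((B.loops _ (hpK a haN) v hv _ _ hπ).1 hR)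

lemma hasDetour_of_card_levelSet_eq_two (B : Beliefs H L K r N Γ) (hr : 1 ≤ r)
    (hpK : ∀ s < N, p s ∈ K) (hp : IsInducedOn H (Set.Iio N) p) (hN : 2 ≤ N) (hv : v ∈ K)
    (hi : i < N) (hiL : p i ∈ L) (hh : h ≤ r)
    (hcard : #(levelSet N (clusterDist H L r p i) h) = 2)
    (ha : a ∈ levelSet N (clusterDist H L r p i) h) (hva : H.edist v (p a) ≤ (r + 1 : ℕ)) :
    HasDetour H (Γ v) (cluster H L (2 * r) (p i)) r N p := by
  obtain ⟨b, hab⟩ : ∃ b, levelSet N (clusterDist H L r p i) h = {a, b} := by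
    obtain ⟨b, hb⟩ := Finset.card_eq_one.1 ((Finset.card_erase_of_mem ha).trans (by rw [hcard]))
    exact ⟨b, by rw [← Finset.insert_erase ha, hb]⟩
  have haK := hpK a (mem_levelSet.1 ha).1
  obtain ⟨hπ, hR⟩ := B.realizes_clusterPattern hr hpK hp hN hi hiL hh hab
  exact B.hasDetour_of_realizes hr hpK hp hv hi hiL hh hab ((B.table v hv _ haK hva _ _ hπ).2 hR)

/-- Otherwise the path stays close to a single cluster, and the belief of this cluster contains
it. -/
lemma levelSet_nonempty (B : Beliefs H L K r N Γ) (hr : 1 ≤ r) (hpK : ∀ s < N, p s ∈ K)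
    (hp : IsInducedOn H (Set.Iio N) p) (hi : i < N) (hiL : p i ∈ L) (hh : h ≤ r) :
    (levelSet N (clusterDist H L r p i) h).Nonempty := by
  obtain ⟨s, hs, hsL, hunlinked, -⟩ := B.exists_unlinked_not_hasDetour hr hpK hp (hpK i hi)
  have hfar : h < clusterDist H L r p i s := by
    by_contra! hle
    exact hunlinked (Linked.of_mem_cthickening_of_mem (by omega)
      ((mem_cthickening_iff_clusterDist_le hp hi hiL hs).2 hle) hsL)
  obtain ⟨j, hj, hjh⟩ := (smallSteps_clusterDist (r := r) hp hi hiL).exists_mem_uIcc_eq hi hs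
    (Set.mem_uIcc.2 (.inl ⟨(clusterDist_self hiL).trans_le h.zero_le, hfar.le⟩))
  exact ⟨j, mem_levelSet.2 ⟨(Set.mem_uIcc.1 hj).elim (·.2.trans_lt hs) (·.2.trans_lt hi), hjh⟩⟩

lemma exists_unlinked_meetsLevelsTwice (B : Beliefs H L K r N Γ) (hr : 1 ≤ r)
    (hpK : ∀ s < N, p s ∈ K) (hp : IsInducedOn H (Set.Iio N) p) (hN : 2 ≤ N) (hw : w ∈ K) :
    ∃ i < N, p i ∈ L ∧ ¬ Linked H L (2 * r) w (p i) ∧ MeetsLevelsTwice H L r N p i ∧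
      ¬ HasDetour H (Γ w) (cluster H L (2 * r) (p i)) r N p := by
  obtain ⟨i, hi, hiL, hunlinked, hdetour⟩ := B.exists_unlinked_not_hasDetour hr hpK hp hw
  refine ⟨i, hi, hiL, hunlinked, fun h hh ↦ ?_, hdetour⟩
  have hpos := (B.levelSet_nonempty hr hpK hp hi hiL hh).card_pos
  have hne := mt (B.hasDetour_of_card_levelSet_eq_one hr hpK hp hN hw hi hiL hh) hdetour
  omega

/-- A vertex halfway between the first cluster and a vertex `p a` of the path at the level `h` of
the second cluster knows both the rows of the first cluster and the pattern at level `h`. -/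
lemma le_of_visible_level (B : Beliefs H L K r N Γ) (hr : 1 ≤ r) (hpK : ∀ s < N, p s ∈ K)
    (hp : IsInducedOn H (Set.Iio N) p) (hN : 2 ≤ N) (h₁ : i₁ < N) (h₂ : i₂ < N)
    (hL₁ : p i₁ ∈ L) (hL₂ : p i₂ ∈ L) (h₁₂ : ¬ Linked H L (2 * r) (p i₁) (p i₂))
    (hm₁ : MeetsLevelsTwice H L r N p i₁) (hm₂ : MeetsLevelsTwice H L r N p i₂) (hh : h ≤ r)
    (hcard : #(levelSet N (clusterDist H L r p i₂) h) = 2)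
    (ha : a ∈ levelSet N (clusterDist H L r p i₂) h)
    (hvisible : clusterDist H L r p i₁ a < 2 * (r + 1)) : 6 * (r + 1) ≤ N := by
  obtain ⟨w, hw, hwa⟩ : p a ∈ cthickening H (cluster H L (2 * r) (p i₁)) (r + (r + 1)) :=
    (mem_cthickening_iff_clusterDist_le hp h₁ hL₁ (mem_levelSet.1 ha).1).2 (by omega)
  obtain ⟨v, hwv, hva⟩ := exists_edist_le_of_edist_le_add hwa
  have hwK := (B.eq_of_linked (hpK i₁ h₁) hw).1
  have hvK := B.mem_of_edist_le hwK hwv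
  obtain ⟨i₃, h₃, hL₃, hw₃, hm₃, hdetour⟩ := B.exists_unlinked_meetsLevelsTwice hr hpK hp hN hwK
  rw [← B.eq_of_edist_le v hvK w hw.right_mem hwv] at hdetour
  have h₂₃ : ¬ Linked H L (2 * r) (p i₂) (p i₃) := fun h₂₃ ↦ hdetour (h₂₃.cluster_eq ▸
    B.hasDetour_of_card_levelSet_eq_two hr hpK hp hN hvK h₂ hL₂ hh hcard ha hva)
  exact le_of_three_meetsLevelsTwice hp h₁ h₂ h₃ hL₁ hL₂ hL₃ h₁₂
    (fun h₁₃ ↦ hw₃ ((Linked.symm hw).trans h₁₃)) h₂₃ hm₁ hm₂ hm₃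

theorem not_isInducedOn (B : Beliefs H L K r N Γ) (hr : 1 ≤ r) (hN2 : 2 ≤ N)
    (hN : 3 * N < 14 * (r + 1)) (hpK : ∀ s < N, p s ∈ K) : ¬ IsInducedOn H (Set.Iio N) p := by
  intro hp
  obtain ⟨i₁, h₁, hL₁, -, hm₁, -⟩ :=
    B.exists_unlinked_meetsLevelsTwice hr hpK hp hN2 (hpK 0 (zero_lt_two.trans_le hN2))
  obtain ⟨i₂, h₂, hL₂, h₁₂, hm₂, -⟩ :=
    B.exists_unlinked_meetsLevelsTwice hr hpK hp hN2 (hpK i₁ h₁)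
  suffices 6 * (r + 1) ≤ N by omega
  obtain ⟨h, hh, hcard, a, ha, hvisible⟩ | ⟨h, hh, hcard, a, ha, hvisible⟩ :=
    exists_visible_level (Nat.le_add_left 1 r) hN
      (smallSteps_clusterDist hp h₁ hL₁) (smallSteps_clusterDist hp h₂ hL₂)
      (fun s hs ↦ le_clusterDist_add_clusterDist hp h₁ h₂ hL₁ hL₂ h₁₂ hs)
      (fun h hh ↦ hm₁ h (Nat.lt_succ_iff.1 hh)) (fun h hh ↦ hm₂ h (Nat.lt_succ_iff.1 hh))
  · exact B.le_of_visible_level hr hpK hp hN2 h₂ h₁ hL₂ hL₁ (fun h ↦ h₁₂ h.symm) hm₂ hm₁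
      (Nat.lt_succ_iff.1 hh) hcard ha hvisible
  · exact B.le_of_visible_level hr hpK hp hN2 h₁ h₂ hL₁ hL₂ h₁₂ hm₁ hm₂
      (Nat.lt_succ_iff.1 hh) hcard ha hvisible

end Beliefs

end Path

section Certificates

variable {W : Type*} {H H' Γ : SimpleGraph W} {r N : ℕ} {c : W}

/-- The part of a certificate that is the same at all the vertices of a connected graph. -/
structure SharedPart (W : Type*) where
  /-- the vertices whose rows of the adjacency matrix are not part of the shared information -/
  big : Finset W
  /-- the adjacent pairs whose first vertex is not big -/
  lowAdj : Finset (W × W)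
  /-- the pairs formed by a big vertex and the label of its cluster -/
  labels : Finset (W × W)
  /-- the patterns that are realized with both distinguished vertices equal to a given vertex -/
  loops : Finset (W × Pattern)
deriving Inhabited

/-- A certificate, before it is encoded as a bit string. -/
structure Certificate (W : Type*) where
  shared : SharedPart W
  /-- the patterns that are realized with the owner of the certificate as first distinguished
  vertex, together with the second distinguished vertex -/
  table : Finset (W × Pattern)
  /-- the adjacent pairs whose first vertex is one of some big vertices -/
  rows : Finset (W × W)
deriving Inhabited

/-- The number of entries in a certificate, which determines its length up to the length of the
encoding of an entry. -/
def Certificate.entryCount {W : Type*} (C : Certificate W) : ℕ :=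
  #C.shared.big + #C.shared.lowAdj + #C.shared.labels + #C.shared.loops + #C.table + #C.rows

/-- All the vertices and patterns mentioned in the certificate `C` are in `X` and `P`. -/
structure Certificate.IsOver {W : Type*} (C : Certificate W) (X : Finset W) (P : Finset Pattern) :
    Prop where
  big : C.shared.big ⊆ X
  lowAdj : C.shared.lowAdj ⊆ X ×ˢ X
  labels : C.shared.labels ⊆ X ×ˢ X
  loops : C.shared.loops ⊆ X ×ˢ P
  table : C.table ⊆ X ×ˢ P
  rows : C.rows ⊆ X ×ˢ X

/-- The shared information `D` is correct for the graph `Γ`, which has no induced path on `N`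
vertices. -/
structure SharedPart.Describes (D : SharedPart W) (r N : ℕ) (Γ : SimpleGraph W) : Prop where
  mem_lowAdj : ∀ a ∉ D.big, ∀ b, (a, b) ∈ D.lowAdj ↔ Γ.Adj a b
  linked_iff : ∀ w ∈ D.big, ∀ w' ∈ D.big,
    Linked Γ D.big (2 * r) w w' ↔ ∃ l, (w, l) ∈ D.labels ∧ (w', l) ∈ D.labels
  mem_loops : ∀ x, ∀ π ∈ patterns r N, (x, π) ∈ D.loops ↔ Realizes Γ D.big r x x π
  free : ¬ ∃ p, IsInducedOn Γ (Set.Iio N) p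

/-- With the certificates `Φ`, nothing within distance `r + 1` of the vertex `c` of the network `H`
contradicts the belief that the whole graph is `Γ`. A big vertex close to `c` must find among its
neighbours the rows of all the big vertices. -/
structure IsPlausible (H : SimpleGraph W) (Φ : W → Certificate W) (r N : ℕ) (c : W)
    (Γ : SimpleGraph W) : Prop where
  shared_eq : ∀ u, H.Adj c u → (Φ u).shared = (Φ c).shared
  describes : (Φ c).shared.Describes r N Γ
  adj_self : ∀ b, Γ.Adj c b ↔ H.Adj c b
  exists_row : ∀ w ∈ (Φ c).shared.big, H.edist c w ≤ r → ∀ z ∈ (Φ c).shared.big,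
    ∃ u, H.Adj w u ∧ ∃ b, (z, b) ∈ (Φ u).rows
  mem_rows : ∀ w ∈ (Φ c).shared.big, H.edist c w ≤ r → ∀ z ∈ (Φ c).shared.big,
    ∀ u, H.Adj w u → (∃ b, (z, b) ∈ (Φ u).rows) → ∀ b, (z, b) ∈ (Φ u).rows ↔ Γ.Adj z b
  mem_table : ∀ x, H.edist c x ≤ (r + 1 : ℕ) → ∀ u, ∀ π ∈ patterns r N,
    (u, π) ∈ (Φ x).table ↔ Realizes Γ (Φ c).shared.big r x u π

variable {Φ Φ' : W → Certificate W}

lemma IsPlausible.congr (h : IsPlausible H Φ r N c Γ)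
    (hadj : ∀ a, H.edist c a ≤ r → ∀ b, H'.Adj a b ↔ H.Adj a b)
    (hΦ : ∀ u, H.edist c u ≤ (r + 1 : ℕ) → Φ' u = Φ u) : IsPlausible H' Φ' r N c Γ := by
  have hedist {n : ℕ} (hn : n ≤ r + 1) (z : W) : H'.edist c z ≤ n ↔ H.edist c z ≤ n :=
    edist_le_iff_of_adj_iff hadj hn
  have hself : H.edist c c ≤ r := by simp
  have hsucc {w u : W} (hw : H.edist c w ≤ r) (hu : H.Adj w u) : H.edist c u ≤ (r + 1 : ℕ) :=
    edist_le_succ_iff.2 (.inr ⟨w, hw, hu⟩)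
  have hc : Φ' c = Φ c := hΦ c (by simp)
  refine ⟨fun u hu ↦ ?_, hc ▸ h.describes, fun b ↦ (h.adj_self b).trans (hadj c hself b).symm,
    fun w hwL hw z hz ↦ ?_, fun w hwL hw z hz u hu ↦ ?_, fun x hx ↦ ?_⟩
  · rw [hadj c hself] at hu
    rw [hc, hΦ u (hsucc hself hu), h.shared_eq u hu]
  · rw [hedist r.le_succ] at hw
    obtain ⟨u, hu, hb⟩ := h.exists_row w (hc ▸ hwL) hw z (hc ▸ hz)
    exact ⟨u, (hadj w hw u).2 hu, hΦ u (hsucc hw hu) ▸ hb⟩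
  · rw [hedist r.le_succ] at hw
    rw [hadj w hw] at hu
    rw [hΦ u (hsucc hw hu)]
    exact h.mem_rows w (hc ▸ hwL) hw z (hc ▸ hz) u hu
  · rw [hedist le_rfl] at hx
    rw [hc, hΦ x hx]
    exact h.mem_table x hx

lemma IsPlausible.eq_of_edist_le {w : W} {Γ' : SimpleGraph W} (hc : IsPlausible H Φ r N c Γ)
    (hw : IsPlausible H Φ r N w Γ') (hshared : (Φ c).shared = (Φ w).shared)
    (hwL : w ∈ (Φ w).shared.big) (hcw : H.edist c w ≤ r) : Γ = Γ' := by
  ext z b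
  by_cases hz : z ∈ (Φ w).shared.big
  · have hself : H.edist w w ≤ r := by simp
    obtain ⟨u, hwu, hrow⟩ := hw.exists_row w hwL hself z hz
    rw [← hw.mem_rows w hwL hself z hz u hwu hrow,
      hc.mem_rows w (hshared ▸ hwL) hcw z (hshared ▸ hz) u hwu hrow]
  · rw [← hw.describes.mem_lowAdj z hz, ← hc.describes.mem_lowAdj z (hshared ▸ hz), hshared]

lemma beliefs_of_isPlausible {K : Set W} {D : SharedPart W} {Γ : W → SimpleGraph W}
    (hK : ∀ a ∈ K, ∀ b, H.Adj a b → b ∈ K) (hD : ∀ c ∈ K, (Φ c).shared = D)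
    (h : ∀ c ∈ K, IsPlausible H Φ r N c (Γ c)) : Beliefs H D.big K r N Γ := by
  have hdescribes : ∀ c ∈ K, D.Describes r N (Γ c) := fun c hc ↦ hD c hc ▸ (h c hc).describes
  refine ⟨hK, fun v hv ↦ (h v hv).adj_self, fun v hv v' hv' a ha b ↦ ?_,
    fun v hv w hw hwv ↦ ?_, fun v hv v' hv' w hw w' hw' ↦ ?_, fun v hv v' hv' x π hπ ↦ ?_,
    fun v hv x hx hvx u π hπ ↦ ?_, fun v hv ↦ (hdescribes v hv).free⟩
  · rw [← (hdescribes v hv).mem_lowAdj a ha, (hdescribes v' hv').mem_lowAdj a ha]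
  · have hwK := mem_of_edist_le hK hv (edist_le_symm hwv)
    exact (h v hv).eq_of_edist_le (h w hwK) ((hD v hv).trans (hD w hwK).symm)
      ((hD w hwK).symm ▸ hw) (edist_le_symm hwv)
  · rw [(hdescribes v hv).linked_iff w hw w' hw', (hdescribes v' hv').linked_iff w hw w' hw']
  · rw [← (hdescribes v hv).mem_loops x π hπ, (hdescribes v' hv').mem_loops x π hπ]
  · have htable := (h v hv).mem_table x hvx u π hπ
    have htable' := (h x hx).mem_table x (by simp) u π hπ
    rw [hD v hv] at htable
    rw [hD x hx] at htable'
    exact htable.symm.trans htable'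

theorem not_isInducedOn_of_isPlausible (hr : 1 ≤ r) (hN2 : 2 ≤ N) (hN : 3 * N < 14 * (r + 1))
    (h : ∀ c ∈ H.support, ∃ Γ, IsPlausible H Φ r N c Γ) (p : ℕ → W) :
    ¬ IsInducedOn H (Set.Iio N) p := by
  intro hp
  choose! Γ hΓ using h
  have hreach : ∀ s < N, H.Reachable (p 0) (p s) := fun s hs ↦ by
    have hedist := hp.edist_le (s := 0) s (by omega)
    rw [zero_add] at hedist
    exact SimpleGraph.reachable_of_edist_ne_top (hedist.trans_lt (ENat.natCast_lt_top _)).ne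
  have hwalk {c : W} (hc : H.Reachable (p 0) c) :
      c ∈ H.support ∧ (Φ c).shared = (Φ (p 0)).shared := by
    rw [SimpleGraph.reachable_iff_reflTransGen] at hc
    induction hc with
    | refl => exact ⟨hp.mem_support hN2 (by omega), rfl⟩
    | tail _ hadj ih => exact ⟨⟨_, hadj.symm⟩, ((hΓ _ ih.1).shared_eq _ hadj).trans ih.2⟩
  exact (beliefs_of_isPlausible (K := {c | H.Reachable (p 0) c})
    (fun a ha b hab ↦ ha.trans hab.reachable) (fun c hc ↦ (hwalk hc).2)
    (fun c hc ↦ hΓ c (hwalk hc).1)).not_isInducedOn hr hN2 hN hreach hp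

end Certificates

section HonestCertificate

open scoped Classical in
/-- A label of the cluster of `w`: one of its vertices. -/
noncomputable def clusterLabel {W : Type*} (H : SimpleGraph W) (L : Set W) (r : ℕ) (w : W) : W :=
  if hw : (cluster H L (2 * r) w).Nonempty then hw.some else w

open scoped Classical in
/-- The correct shared information about a graph `H` all of whose edges join vertices of `X`. -/
noncomputable def honestShared {W : Type*} (H : SimpleGraph W) (X L : Finset W) (r N : ℕ) :
    SharedPart W where
  big := L
  lowAdj := {e ∈ X ×ˢ X | e.1 ∉ L ∧ H.Adj e.1 e.2}
  labels := L.image fun w ↦ (w, clusterLabel H L r w)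
  loops := {e ∈ X ×ˢ patterns r N | Realizes H L r e.1 e.1 e.2}

open scoped Classical in
/-- The correct certificate of the vertex `v` of a graph `H` all of whose edges join vertices
of `X`. It contains the rows of the vertices of `L` whose key is the colour of `v`. -/
noncomputable def honestCertificate {W ι : Type*} (H : SimpleGraph W) (X L : Finset W) (r N : ℕ)
    (colour key : W → ι) (v : W) : Certificate W where
  shared := honestShared H X L r N
  table := {e ∈ X ×ˢ patterns r N | Realizes H L r v e.1 e.2}
  rows := {e ∈ X ×ˢ X | e.1 ∈ L ∧ key e.1 = colour v ∧ H.Adj e.1 e.2}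

variable {W ι : Type*} {H : SimpleGraph W} {X L : Finset W} {r N m : ℕ} {colour key : W → ι}

lemma linked_clusterLabel {L : Set W} {w : W} (hw : w ∈ L) :
    Linked H L (2 * r) w (clusterLabel H L r w) := by
  have hne : (cluster H L (2 * r) w).Nonempty := ⟨w, .refl hw⟩
  rw [clusterLabel, dif_pos hne]
  exact hne.some_mem

lemma linked_iff_clusterLabel_eq {L : Set W} {w w' : W} (hw : w ∈ L) (hw' : w' ∈ L) :
    Linked H L (2 * r) w w' ↔ clusterLabel H L r w = clusterLabel H L r w' := by
  constructor
  · intro h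
    have hne : (cluster H L (2 * r) w).Nonempty := ⟨w, .refl hw⟩
    have hne' : (cluster H L (2 * r) w').Nonempty := ⟨w', .refl hw'⟩
    simp only [clusterLabel, dif_pos hne, dif_pos hne', h.cluster_eq]
  · intro h
    exact (linked_clusterLabel hw).trans (h ▸ (linked_clusterLabel hw').symm)

lemma honestShared_describes (hX : H.support ⊆ X) (hfree : ¬ ∃ p, IsInducedOn H (Set.Iio N) p) :
    (honestShared H X L r N).Describes r N H := by
  refine ⟨fun a ha b ↦ ?_, fun w hw w' hw' ↦ ?_, fun x π hπ ↦ ?_, hfree⟩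
  · have hmem : H.Adj a b → a ∈ X ∧ b ∈ X := fun h ↦ ⟨hX ⟨b, h⟩, hX ⟨a, h.symm⟩⟩
    simp only [honestShared] at ha ⊢
    simp only [Finset.mem_filter, Finset.mem_product]
    tauto
  · rw [linked_iff_clusterLabel_eq hw hw']
    simp only [honestShared] at hw hw' ⊢
    simp [hw, hw', eq_comm]
  · have hmem : Realizes H L r x x π → x ∈ X := fun h ↦ hX h.1
    simp only [honestShared, Finset.mem_filter, Finset.mem_product]
    tauto

lemma honestCertificate_isPlausible (hX : H.support ⊆ X)
    (hfree : ¬ ∃ p, IsInducedOn H (Set.Iio N) p)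
    (hcolour : ∀ w ∈ L, ∀ z ∈ L, ∃ u, H.Adj w u ∧ colour u = key z) (c : W) :
    IsPlausible H (honestCertificate H X L r N colour key) r N c H := by
  have hmem : ∀ a b, H.Adj a b → a ∈ X ∧ b ∈ X := fun a b h ↦ ⟨hX ⟨b, h⟩, hX ⟨a, h.symm⟩⟩
  have hrow : ∀ u z b, (z, b) ∈ (honestCertificate H X L r N colour key u).rows ↔
      z ∈ L ∧ key z = colour u ∧ H.Adj z b := fun u z b ↦ by
    simp only [honestCertificate, Finset.mem_filter, Finset.mem_product]
    exact and_iff_right_of_imp fun h ↦ hmem z b h.2.2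
  refine ⟨fun _ _ ↦ rfl, honestShared_describes hX hfree, fun _ ↦ Iff.rfl,
    fun w hw _ z hz ↦ ?_, fun w _ _ z _ u _ ⟨b, hzb⟩ b' ↦ ?_, fun x _ u π hπ ↦ ?_⟩
  · obtain ⟨u, hwu, hu⟩ := hcolour w hw z hz
    obtain ⟨b, hzb, -⟩ := hcolour z hz z hz
    exact ⟨u, hwu, b, (hrow u z b).2 ⟨hz, hu.symm, hzb⟩⟩
  · rw [hrow] at hzb ⊢
    tauto
  · have hu : Realizes H L r x u π → u ∈ X := fun h ↦ hX h.2.1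
    simp only [honestCertificate, honestShared, Finset.mem_filter, Finset.mem_product]
    tauto

open scoped Classical in
lemma card_lowAdj_honestShared_le (hm : ∀ a ∈ X, a ∉ L → #{b ∈ X | H.Adj a b} ≤ m) :
    #(honestShared H X L r N).lowAdj ≤ m * #X := by
  refine Finset.card_le_mul_card_image_of_maps_to (f := Prod.fst) (fun e he ↦ ?_) m fun a ha ↦ ?_
  · simp only [honestShared, Finset.mem_filter, Finset.mem_product] at he
    exact he.1.1
  · by_cases haL : a ∈ L
    · refine (Finset.card_eq_zero.2 (Finset.filter_eq_empty_iff.2 fun e he hea ↦ ?_)).trans_le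
        m.zero_le
      simp only [honestShared, Finset.mem_filter] at he
      exact he.2.1 (hea ▸ haL)
    · refine (Finset.card_le_card_of_injOn Prod.snd (fun e he ↦ ?_) ?_).trans (hm a ha haL)
      · simp only [honestShared, Finset.coe_filter, Set.mem_ofPred_eq, Finset.mem_filter,
          Finset.mem_product] at he ⊢
        exact ⟨he.1.1.2, he.2 ▸ he.1.2.2⟩
      · intro e he e' he' h
        exact Prod.ext ((Finset.mem_filter.1 he).2.trans (Finset.mem_filter.1 he').2.symm) h

open scoped Classical in
lemma card_rows_honestCertificate_le [DecidableEq ι] (hm : ∀ i, #{z ∈ X | key z = i} ≤ m) (v : W) :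
    #(honestCertificate H X L r N colour key v).rows ≤ m * #X := by
  refine (Finset.card_le_card (t := {z ∈ X | key z = colour v} ×ˢ X) fun e he ↦ ?_).trans
    ((Finset.card_product _ _).trans_le (Nat.mul_le_mul_right _ (hm _)))
  simp only [honestCertificate, Finset.mem_filter, Finset.mem_product] at he ⊢
  tauto

open scoped Classical in
lemma honestCertificate_isOver (hL : L ⊆ X) (v : W) :
    (honestCertificate H X L r N colour key v).IsOver X (patterns r N) where
  big := hL
  lowAdj := Finset.filter_subset _ _
  labels := Finset.image_subset_iff.2 fun _ hw ↦
    Finset.mk_mem_product (hL hw) (hL (linked_clusterLabel hw).right_mem)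
  loops := Finset.filter_subset _ _
  table := Finset.filter_subset _ _
  rows := Finset.filter_subset _ _

open scoped Classical in
lemma entryCount_honestCertificate_le [DecidableEq ι] {m' : ℕ} (hL : L ⊆ X)
    (hm : ∀ a ∈ X, a ∉ L → #{b ∈ X | H.Adj a b} ≤ m)
    (hm' : ∀ i, #{z ∈ X | key z = i} ≤ m') (v : W) :
    (honestCertificate H X L r N colour key v).entryCount ≤
      (m + m' + 2 * #(patterns r N) + 2) * #X := by
  have hover := honestCertificate_isOver (H := H) (r := r) (N := N) (colour := colour)
    (key := key) hL v
  have hbig := Finset.card_le_card hL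
  have hloops := Finset.card_le_card hover.loops
  have htable := Finset.card_le_card hover.table
  rw [Finset.card_product] at hloops htable
  rw [Certificate.entryCount]
  calc
    _ ≤ #X + m * #X + #X + #X * #(patterns r N) + #X * #(patterns r N) + m' * #X := by
      gcongr ?_ + ?_ + ?_ + ?_ + ?_ + ?_
      · exact hbig
      · exact card_lowAdj_honestShared_le hm
      · exact Finset.card_image_le.trans hbig
      · exact card_rows_honestCertificate_le hm' v
    _ = _ := by ring

end HonestCertificate

section PrefixCodes

variable {α β : Type*} {e : α → List Bool} {f : β → List Bool} {b : ℕ}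

/-- The bit strings `e x` can be read off the front of a longer bit string. -/
def IsPrefixCode (e : α → List Bool) : Prop :=
  ∀ ⦃x y l m⦄, e x ++ l = e y ++ m → x = y ∧ l = m

/-- The code of a pair: the concatenation of the codes of its components. -/
def pairCode (e : α → List Bool) (f : β → List Bool) (x : α × β) : List Bool := e x.1 ++ f x.2

/-- The code of a list: each entry is announced by the bit `true`, the end by the bit `false`. -/
def listCode (e : α → List Bool) : List α → List Bool
  | [] => [false]
  | x :: l => true :: (e x ++ listCode e l)

/-- The code of a natural number: the code of the list of its binary digits. -/
def natCode (n : ℕ) : List Bool := listCode (fun bit ↦ [bit]) n.bits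

/-- The code of a finite set: the code of a list of its elements. -/
noncomputable def finsetCode (e : α → List Bool) (s : Finset α) : List Bool :=
  listCode e s.toList

namespace IsPrefixCode

lemma injective (he : IsPrefixCode e) : Function.Injective e := fun x y hxy ↦
  (he (l := []) (m := []) (by simp [hxy])).1

lemma comp {g : β → α} (he : IsPrefixCode e) (hg : Function.Injective g) : IsPrefixCode (e ∘ g) :=
  fun _ _ _ _ h ↦ (he h).imp_left fun hxy ↦ hg hxy

protected lemma pairCode (he : IsPrefixCode e) (hf : IsPrefixCode f) :
    IsPrefixCode (pairCode e f) := fun x y l m h ↦ by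
  simp only [pairCode, List.append_assoc] at h
  obtain ⟨h₁, h⟩ := he h
  obtain ⟨h₂, h⟩ := hf h
  exact ⟨Prod.ext h₁ h₂, h⟩

protected lemma listCode (he : IsPrefixCode e) : IsPrefixCode (listCode e) := by
  intro x
  induction x with
  | nil => rintro (_ | ⟨b, y⟩) l m h <;> simp_all [listCode]
  | cons a x ih =>
    rintro (_ | ⟨b, y⟩) l m h
    · simp [listCode] at h
    · simp only [listCode, List.cons_append, List.append_assoc, List.cons.injEq,
        true_and] at h
      obtain ⟨rfl, htail⟩ := he h
      obtain ⟨rfl, rfl⟩ := ih htail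
      exact ⟨rfl, rfl⟩

protected lemma finsetCode (he : IsPrefixCode e) : IsPrefixCode (finsetCode e) :=
  he.listCode.comp fun s t h ↦ by simpa using congrArg Multiset.ofList h

end IsPrefixCode

lemma isPrefixCode_natCode : IsPrefixCode natCode := by
  refine IsPrefixCode.comp (IsPrefixCode.listCode fun x y l m h ↦ by simpa using h) ?_
  refine Function.LeftInverse.injective (g := fun l ↦ Nat.ofDigits 2 (l.map fun b ↦ cond b 1 0))
    fun n ↦ ?_
  dsimp only
  rw [← Nat.digits_two_eq_bits, Nat.ofDigits_digits]

lemma length_listCode_le {l : List α} (h : ∀ x ∈ l, (e x).length ≤ b) :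
    (listCode e l).length ≤ l.length * (b + 1) + 1 := by
  induction l with
  | nil => simp [listCode]
  | cons x l ih =>
    rw [List.forall_mem_cons] at h
    have hl := ih h.2
    simp only [listCode, List.length_cons, List.length_append] at hl ⊢
    linarith [h.1]

lemma length_natCode_le (n : ℕ) : (natCode n).length ≤ 2 * n.size + 1 := by
  have h := length_listCode_le (e := fun bit : Bool ↦ [bit]) (l := n.bits) (b := 1) (by simp)
  rw [Nat.size_eq_bits_len] at h
  rw [natCode]
  omega

lemma length_finsetCode_le {s : Finset α} (h : ∀ x ∈ s, (e x).length ≤ b) :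
    (finsetCode e s).length ≤ #s * (b + 1) + 1 := by
  rw [← s.length_toList]
  exact length_listCode_le (by simpa using h)

/-- The code of a pattern. -/
noncomputable def patternCode (π : Pattern) : List Bool :=
  pairCode natCode (pairCode (finsetCode natCode) (pairCode natCode natCode))
    (π.level, π.support, π.fst, π.snd)

/-- The bit string that represents a certificate. -/
noncomputable def certificateCode (C : Certificate ℕ) : List Bool :=
  pairCode (finsetCode natCode) (pairCode (finsetCode (pairCode natCode natCode))
    (pairCode (finsetCode (pairCode natCode natCode))
      (pairCode (finsetCode (pairCode natCode patternCode))
        (pairCode (finsetCode (pairCode natCode patternCode))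
          (finsetCode (pairCode natCode natCode))))))
    (C.shared.big, C.shared.lowAdj, C.shared.labels, C.shared.loops, C.table, C.rows)

lemma isPrefixCode_patternCode : IsPrefixCode patternCode := by
  have hnat := isPrefixCode_natCode
  refine IsPrefixCode.comp (hnat.pairCode (hnat.finsetCode.pairCode (hnat.pairCode hnat)))
    fun π π' h ↦ ?_
  obtain ⟨h₁, h₂, h₃, h₄⟩ := by simpa only [Prod.mk.injEq] using h
  cases π
  simp_all

lemma isPrefixCode_certificateCode : IsPrefixCode certificateCode := by
  have hnat := isPrefixCode_natCode
  have hentry := (hnat.pairCode hnat).finsetCode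
  have hpattern := (hnat.pairCode isPrefixCode_patternCode).finsetCode
  refine IsPrefixCode.comp (hnat.finsetCode.pairCode (hentry.pairCode (hentry.pairCode
    (hpattern.pairCode (hpattern.pairCode hentry))))) fun C C' h ↦ ?_
  obtain ⟨⟨_, _, _, _⟩, _, _⟩ := C
  obtain ⟨⟨_, _, _, _⟩, _, _⟩ := C'
  simp_all

lemma length_certificateCode_le {C : Certificate ℕ} {X : Finset ℕ} {P : Finset Pattern} {d : ℕ}
    (hC : C.IsOver X P) (hX : ∀ a ∈ X, (natCode a).length ≤ b)
    (hP : ∀ π ∈ P, (patternCode π).length ≤ d) :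
    (certificateCode C).length ≤ C.entryCount * (2 * b + d + 1) + 6 := by
  have hnat {s : Finset ℕ} (hs : s ⊆ X) :
      (finsetCode natCode s).length ≤ #s * (2 * b + d + 1) + 1 :=
    length_finsetCode_le fun a ha ↦ by have := hX a (hs ha); omega
  have hentry {s : Finset (ℕ × ℕ)} (hs : s ⊆ X ×ˢ X) :
      (finsetCode (pairCode natCode natCode) s).length ≤ #s * (2 * b + d + 1) + 1 :=
    length_finsetCode_le fun e he ↦ by
      obtain ⟨h₁, h₂⟩ := (Finset.mem_product.1 (hs he)).imp (hX _) (hX _)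
      rw [pairCode, List.length_append]
      omega
  have hpattern {s : Finset (ℕ × Pattern)} (hs : s ⊆ X ×ˢ P) :
      (finsetCode (pairCode natCode patternCode) s).length ≤ #s * (2 * b + d + 1) + 1 :=
    length_finsetCode_le fun e he ↦ by
      obtain ⟨h₁, h₂⟩ := (Finset.mem_product.1 (hs he)).imp (hX _) (hP _)
      rw [pairCode, List.length_append]
      omega
  simp only [certificateCode, Certificate.entryCount, pairCode, List.length_append]
  linarith [hnat hC.big, hentry hC.lowAdj, hentry hC.labels, hpattern hC.loops,
    hpattern hC.table, hentry hC.rows]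

end PrefixCodes

section Colourings

lemma two_mul_pred_pow_le {q : ℕ} (hq : 1 ≤ q) : 2 * (q - 1) ^ q ≤ q ^ q := by
  obtain ⟨m, rfl⟩ := Nat.exists_eq_add_of_le' hq
  calc 2 * m ^ (m + 1) ≤ m ^ m * (m + 1) + m ^ (m + 1) := by
        rw [pow_succ]; linarith [Nat.zero_le (m ^ m)]
    _ ≤ (m + 1) ^ (m + 1) := by
        rw [add_pow, Finset.sum_range_succ, Finset.sum_range_succ]
        simp [add_assoc]

lemma card_filter_forall_ne_mul_le {V : Type*} [Fintype V] [DecidableEq V] {q t : ℕ}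
    (hq : 1 ≤ q) {A : Finset V} (hA : q * t ≤ #A) (i : Fin q) :
    #{κ : V → Fin q | ∀ u ∈ A, κ u ≠ i} * 2 ^ t ≤ q ^ Fintype.card V := by
  have hfilter : ({κ | ∀ u ∈ A, κ u ≠ i} : Finset (V → Fin q)) =
      Fintype.piFinset fun u ↦ if u ∈ A then {i}ᶜ else Finset.univ := by
    ext κ
    simp only [Finset.mem_filter_univ, Fintype.mem_piFinset]
    refine forall_congr' fun u ↦ ?_
    split_ifs with hu <;> simp [hu]
  have hpow : (q - 1) ^ #A * 2 ^ t ≤ q ^ #A := by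
    have hpred : q - 1 ≤ q := q.sub_le 1
    obtain ⟨d, hd⟩ := Nat.exists_eq_add_of_le hA
    calc (q - 1) ^ #A * 2 ^ t = (2 * (q - 1) ^ q) ^ t * (q - 1) ^ d := by rw [hd]; ring
      _ ≤ (q ^ q) ^ t * q ^ d := by gcongr; exact two_mul_pred_pow_le hq
      _ = q ^ #A := by rw [hd]; ring
  calc #{κ : V → Fin q | ∀ u ∈ A, κ u ≠ i} * 2 ^ t
      = (q - 1) ^ #A * q ^ #Aᶜ * 2 ^ t := by
        simp [hfilter, Fintype.card_piFinset, apply_ite Finset.card, Finset.prod_ite,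
          Finset.filter_not, Finset.compl_eq_univ_sdiff, Finset.card_univ_sdiff]
    _ = (q - 1) ^ #A * 2 ^ t * q ^ #Aᶜ := by ring
    _ ≤ q ^ #A * q ^ #Aᶜ := Nat.mul_le_mul_right _ hpow
    _ = q ^ Fintype.card V := by rw [← pow_add, Finset.card_add_card_compl]

/-- A random colouring works: the union bound over the sets `𝒩 w` and the colours. -/
lemma exists_forall_exists_mem_eq {V ι : Type*} [Finite V] [Fintype ι] (𝒩 : ι → Finset V)
    {q t : ℕ} (hq : 1 ≤ q) (h𝒩 : ∀ w, q * t ≤ #(𝒩 w)) (ht : Fintype.card ι * q < 2 ^ t) :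
    ∃ κ : V → Fin q, ∀ w i, ∃ u ∈ 𝒩 w, κ u = i := by
  classical
  have := Fintype.ofFinite V
  let bad (x : ι × Fin q) : Finset (V → Fin q) := {κ | ∀ u ∈ 𝒩 x.1, κ u ≠ x.2}
  have hbad : #(Finset.univ.biUnion bad) * 2 ^ t < Fintype.card (V → Fin q) * 2 ^ t :=
    calc #(Finset.univ.biUnion bad) * 2 ^ t
        ≤ ∑ x, #(bad x) * 2 ^ t := by
          rw [← Finset.sum_mul]
          exact Nat.mul_le_mul_right _ Finset.card_biUnion_le
      _ ≤ ∑ _x : ι × Fin q, q ^ Fintype.card V :=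
          Finset.sum_le_sum fun x _ ↦ card_filter_forall_ne_mul_le hq (h𝒩 x.1) x.2
      _ = Fintype.card (V → Fin q) * (Fintype.card ι * q) := by simp [mul_comm]
      _ < _ := Nat.mul_lt_mul_of_pos_left ht (Fintype.card_pos_iff.2 ⟨fun _ ↦ ⟨0, hq⟩⟩)
  obtain ⟨κ, -, hκ⟩ := Finset.exists_mem_notMem_of_card_lt_card
    (Finset.card_univ (α := V → Fin q) ▸ lt_of_mul_lt_mul_right' hbad)
  simp only [bad, Finset.mem_biUnion, Finset.mem_univ, true_and, Finset.mem_filter_univ,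
    not_exists, Prod.forall] at hκ
  exact ⟨κ, fun w i ↦ by simpa using hκ w i⟩

lemma exists_forall_card_filter_eq_le {V : Type*} [Fintype V] {x q : ℕ}
    (h : Fintype.card V ≤ x * q) :
    ∃ κ : V → Fin q, ∀ i, #{z | κ z = i} ≤ x := by
  obtain ⟨f⟩ : Nonempty (V ↪ Fin x × Fin q) :=
    Function.Embedding.nonempty_of_card_le (by simpa using h)
  refine ⟨fun z ↦ (f z).2, fun i ↦ ?_⟩
  calc #{z | (f z).2 = i} ≤ #(Finset.univ : Finset (Fin x)) :=
        Finset.card_le_card_of_injOn (fun z ↦ (f z).1) (by simp) fun z hz z' hz' hzz' ↦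
          f.injective (Prod.ext hzz' (by simp_all))
    _ = x := by simp

lemma card_filter_coe_sort {W : Type*} (X : Finset W) (p : W → Prop) [DecidablePred p] :
    #{z : X | p z} = #{z ∈ X | p z} := by
  simp only [Finset.card_filter]
  exact Finset.sum_coe_sort X fun z ↦ if p z then 1 else 0

open scoped Classical in
lemma exists_colour_forall_exists_adj {W : Type*} (H : SimpleGraph W) (X : Finset W) {q t : ℕ}
    (hq : 1 ≤ q) (ht : #X * q < 2 ^ t) :
    ∃ colour : W → Fin q, ∀ w ∈ X, q * t ≤ #{u ∈ X | H.Adj w u} →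
      ∀ i, ∃ u, H.Adj w u ∧ colour u = i := by
  let L : Finset W := {w ∈ X | q * t ≤ #{u ∈ X | H.Adj w u}}
  obtain ⟨κ, hκ⟩ := exists_forall_exists_mem_eq (V := X) (ι := L) (q := q) (t := t)
    (fun w ↦ {u : X | H.Adj w u}) hq
    (fun w ↦ (Finset.mem_filter.1 w.2).2.trans_eq (card_filter_coe_sort X (H.Adj w)).symm)
    ((Nat.mul_le_mul_right q (by simpa using Finset.card_filter_le _ _)).trans_lt ht)
  refine ⟨Function.extend Subtype.val κ fun _ ↦ ⟨0, hq⟩, fun w hw hdeg i ↦ ?_⟩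
  obtain ⟨u, hu, hui⟩ := hκ ⟨w, Finset.mem_filter.2 ⟨hw, hdeg⟩⟩ i
  exact ⟨u, (Finset.mem_filter.1 hu).2, (Subtype.val_injective.extend_apply κ _ u).trans hui⟩

lemma exists_key_forall_card_le {W : Type*} (X : Finset W) {x q : ℕ} (hq : 1 ≤ q)
    (hX : #X ≤ x * q) : ∃ key : W → Fin q, ∀ i, #{z ∈ X | key z = i} ≤ x := by
  obtain ⟨κ, hκ⟩ := exists_forall_card_filter_eq_le (V := X) (by simpa using hX)
  refine ⟨Function.extend Subtype.val κ fun _ ↦ ⟨0, hq⟩, fun i ↦ ?_⟩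
  rw [← card_filter_coe_sort]
  simpa only [Subtype.val_injective.extend_apply] using hκ i

end Colourings

theorem exists_certificates {W : Type*} {H : SimpleGraph W} {X : Finset W} {q t N : ℕ} (r : ℕ)
    (hX : H.support ⊆ X) (hfree : ¬ ∃ p, IsInducedOn H (Set.Iio N) p) (hq : 1 ≤ q)
    (hXq : #X ≤ q * q) (ht : #X * q < 2 ^ t) :
    ∃ Φ : W → Certificate W, ∀ v, IsPlausible H Φ r N v H ∧ (Φ v).IsOver X (patterns r N) ∧
      (Φ v).entryCount ≤ #X * q * (t + (2 * #(patterns r N) + 3)) := by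
  classical
  obtain ⟨colour, hcolour⟩ := exists_colour_forall_exists_adj H X hq ht
  obtain ⟨key, hkey⟩ := exists_key_forall_card_le X hq hXq
  let L : Finset W := {w ∈ X | q * t ≤ #{u ∈ X | H.Adj w u}}
  have hL : L ⊆ X := Finset.filter_subset _ _
  refine ⟨honestCertificate H X L r N colour key, fun v ↦ ⟨honestCertificate_isPlausible hX hfree
    (fun w hw z _ ↦ ?_) v, honestCertificate_isOver hL v,
    (entryCount_honestCertificate_le (m := q * t) hL (fun a ha haL ↦ ?_) hkey v).trans ?_⟩⟩
  · obtain ⟨hwX, hw⟩ := Finset.mem_filter.1 hw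
    exact hcolour w hwX hw (key z)
  · simp only [L, Finset.mem_filter, ha, true_and, not_le] at haL
    exact haL.le
  · rw [mul_comm, mul_assoc]
    gcongr
    nlinarith

section CertificateLength

/-- A bound for the length of the certificates of the vertices of an `n`-vertex graph with
identifiers up to `n ^ c`, if there are `p` patterns with codes of length at most `d`. -/
def certificateLength (c p d n : ℕ) : ℕ :=
  n * (n.sqrt + 1) * (2 * n.size + (2 * p + 3)) * (4 * c * n.size + (d + 13))

lemma size_pow_le (n c : ℕ) : (n ^ c).size ≤ c * n.size + 1 := by
  rw [Nat.size_le]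
  calc n ^ c ≤ (2 ^ n.size) ^ c := Nat.pow_le_pow_left n.lt_size_self.le c
    _ = 2 ^ (c * n.size) := by rw [← pow_mul, mul_comm]
    _ < 2 ^ (c * n.size + 1) := Nat.pow_lt_pow_succ one_lt_two

lemma length_certificateCode_le_certificateLength {C : Certificate ℕ} {X : Finset ℕ}
    {P : Finset Pattern} {n c : ℕ} (hC : C.IsOver X P) (hn : 1 ≤ n) (hX : ∀ a ∈ X, a ≤ n ^ c)
    (hcount : C.entryCount ≤ n * (n.sqrt + 1) * (2 * n.size + (2 * #P + 3))) :
    (certificateCode C).length ≤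
      certificateLength c #P (P.sup fun π ↦ (patternCode π).length) n := by
  set E := n * (n.sqrt + 1) * (2 * n.size + (2 * #P + 3))
  set d := P.sup fun π ↦ (patternCode π).length
  have hnat : ∀ a ∈ X, (natCode a).length ≤ 2 * (c * n.size + 1) + 1 := fun a ha ↦ by
    have hsize := (Nat.size_le_size (hX a ha)).trans (size_pow_le n c)
    exact (length_natCode_le a).trans (by omega)
  have hpattern : ∀ π ∈ P, (patternCode π).length ≤ d := fun π hπ ↦
    Finset.le_sup (f := fun π ↦ (patternCode π).length) hπ
  have hE : 1 ≤ E := Nat.mul_pos (Nat.mul_pos hn (by omega)) (by omega)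
  calc (certificateCode C).length
      ≤ C.entryCount * (2 * (2 * (c * n.size + 1) + 1) + d + 1) + 6 :=
        length_certificateCode_le hC hnat hpattern
    _ ≤ E * (2 * (2 * (c * n.size + 1) + 1) + d + 1) + E * 6 := by gcongr; omega
    _ = certificateLength c #P d n := by rw [certificateLength]; ring

lemma mul_sqrt_add_one_lt (n : ℕ) : n * (n.sqrt + 1) < 2 ^ (2 * n.size) := by
  have hlt : n < 2 ^ n.size := n.lt_size_self
  have hle : n.sqrt + 1 ≤ 2 ^ n.size := Nat.succ_le_of_lt (n.sqrt_le_self.trans_lt hlt)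
  rw [two_mul, pow_add]
  exact Nat.mul_lt_mul_of_lt_of_le hlt hle (by positivity)

lemma isBigO_size_log :
    (fun n : ℕ ↦ (n.size : ℝ)) =O[atTop] fun n : ℕ ↦ Real.log (n : ℝ) := by
  refine IsBigO.of_bound (2 / Real.log 2) ?_
  filter_upwards [eventually_ge_atTop 2] with n hn
  have hsize : 2 ≤ n.size := Nat.lt_size.2 (by simpa using hn)
  have hpow : (2 : ℝ) ^ (n.size - 1) ≤ n := mod_cast Nat.lt_size.1 (by omega)
  have hlog : ((n.size - 1 : ℕ) : ℝ) * Real.log 2 ≤ Real.log n := by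
    rw [← Real.log_pow]
    exact Real.log_le_log (by positivity) hpow
  have hdouble : (n.size : ℝ) ≤ 2 * (n.size - 1 : ℕ) := by norm_cast; omega
  rw [Real.norm_of_nonneg (by positivity), Real.norm_of_nonneg (by positivity),
    div_mul_eq_mul_div, le_div_iff₀ (Real.log_pos one_lt_two)]
  nlinarith [Real.log_pos one_lt_two]

lemma isBigO_const_log (C : ℝ) :
    (fun _ : ℕ ↦ C) =O[atTop] fun n : ℕ ↦ Real.log (n : ℝ) :=
  (Real.isLittleO_const_log_atTop.comp_tendsto tendsto_natCast_atTop_atTop).isBigO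

lemma isBigO_sqrt_add_one_rpow :
    (fun n : ℕ ↦ (n.sqrt + 1 : ℝ)) =O[atTop] fun n : ℕ ↦ (n : ℝ) ^ (1 / 2 : ℝ) := by
  refine IsBigO.of_bound 2 ?_
  filter_upwards [eventually_ge_atTop 1] with n hn
  have hsqrt : (n.sqrt : ℝ) ≤ √n := Real.nat_sqrt_le_real_sqrt
  have hone : 1 ≤ √(n : ℝ) := Real.one_le_sqrt.2 (mod_cast hn)
  rw [← Real.sqrt_eq_rpow, Real.norm_of_nonneg (by positivity), Real.norm_of_nonneg (by positivity)]
  linarith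

theorem isBigO_certificateLength (c p d : ℕ) :
    (fun n : ℕ ↦ (certificateLength c p d n : ℝ)) =O[atTop]
      fun n : ℕ ↦ (n : ℝ) ^ (3 / 2 : ℝ) * Real.log (n : ℝ) ^ 2 := by
  have hlinear (a b : ℝ) : (fun n : ℕ ↦ a * n.size + b) =O[atTop] fun n : ℕ ↦ Real.log (n : ℝ) :=
    (isBigO_size_log.const_mul_left a).add (isBigO_const_log b)
  have hmul := (((isBigO_refl (fun n : ℕ ↦ (n : ℝ)) atTop).mul isBigO_sqrt_add_one_rpow).mul
    (hlinear 2 (2 * p + 3))).mul (hlinear (4 * c) (d + 13))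
  refine hmul.congr (fun n ↦ by simp [certificateLength]) fun n ↦ ?_
  have hrpow : (n : ℝ) ^ (3 / 2 : ℝ) = n * (n : ℝ) ^ (1 / 2 : ℝ) := by
    rw [← Real.rpow_one_add' n.cast_nonneg (by norm_num)]
    norm_num
  rw [hrpow]
  ring

end CertificateLength

section Network

variable {V : Type} {G : SimpleGraph V} {ident : V → ℕ} {cert : V → List Bool} {r N n : ℕ} {v : V}

lemma map_adj_iff (hinj : Function.Injective ident) {u w : V} :
    (G.map ident).Adj (ident u) (ident w) ↔ G.Adj u w := by
  refine ⟨?_, fun h ↦ ⟨hinj.ne h.ne, u, w, h, rfl, rfl⟩⟩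
  rintro ⟨-, x, y, hxy, hx, hy⟩
  rwa [← hinj hx, ← hinj hy]

lemma edist_map_le_iff (hinj : Function.Injective ident) {a : ℕ} :
    (G.map ident).edist (ident v) a ≤ n ↔ ∃ u, ident u = a ∧ G.edist v u ≤ n := by
  induction n generalizing a with
  | zero => simp
  | succ n ih =>
    simp only [edist_le_succ_iff, ih]
    constructor
    · rintro (⟨u, rfl, hu⟩ | ⟨_, ⟨u, rfl, hu⟩, -, x, y, hxy, hx, rfl⟩)
      · exact ⟨u, rfl, .inl hu⟩
      · exact ⟨y, rfl, .inr ⟨u, hu, hinj hx ▸ hxy⟩⟩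
    · rintro ⟨u, rfl, hu | ⟨y, hy, hyu⟩⟩
      · exact .inl ⟨u, rfl, hu⟩
      · exact .inr ⟨ident y, ⟨y, rfl, hy⟩, (map_adj_iff hinj).2 hyu⟩

lemma isIndContained_pathGraph_iff (hinj : Function.Injective ident) (hN : 2 ≤ N) :
    (SimpleGraph.pathGraph N).IsIndContained G ↔
      ∃ p, IsInducedOn (G.map ident) (Set.Iio N) p := by
  constructor
  · rintro ⟨f⟩
    let p (s : ℕ) : ℕ := if hs : s < N then ident (f ⟨s, hs⟩) else 0
    have hp (s : ℕ) (hs : s < N) : p s = ident (f ⟨s, hs⟩) := dif_pos hs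
    refine ⟨p, fun s hs t ht h ↦ ?_, fun s hs t ht ↦ ?_⟩
    · rw [hp s hs, hp t ht] at h
      exact Fin.mk.inj (f.injective (hinj h))
    · rw [hp s hs, hp t ht, map_adj_iff hinj, f.map_adj_iff, SimpleGraph.pathGraph_adj]
  · rintro ⟨p, hp⟩
    have hident (s : Fin N) : ∃ u, ident u = p s := by
      obtain ⟨_, -, u, _, -, hu, -⟩ := hp.mem_support hN s.isLt
      exact ⟨u, hu⟩
    choose f hf using hident
    refine ⟨⟨f, fun s t h ↦ ?_⟩, fun {s t} ↦ ?_⟩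
    · exact Fin.ext (hp.injOn s.isLt t.isLt (by rw [← hf, ← hf, h]))
    · change G.Adj (f s) (f t) ↔ _
      rw [← map_adj_iff hinj, hf, hf, hp.adj_iff s s.isLt t t.isLt, SimpleGraph.pathGraph_adj]

/-- The graph of the visible edges of a view. -/
def viewGraph (view : LocalView) : SimpleGraph ℕ :=
  SimpleGraph.fromEdgeSet view.edges

/-- The certificate encoded by the label of the vertex `a` in a set of labels, and a junk value if
there is none. -/
noncomputable def readCertificate (labels : Set (ℕ × List Bool)) (a : ℕ) : Certificate ℕ :=
  Classical.epsilon fun C ↦ (a, certificateCode C) ∈ labels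

/-- The condition checked by the verification algorithm: the view is plausible for some belief about
the whole network. -/
def Verifies (r N : ℕ) (view : LocalView) : Prop :=
  ∃ Γ, IsPlausible (viewGraph view) (readCertificate view.labels) r N view.center Γ

lemma viewGraph_viewAt_adj_iff (hinj : Function.Injective ident) {a b : ℕ}
    (ha : (G.map ident).edist (ident v) a ≤ r) :
    (viewGraph (viewAt G ident cert (r + 1) v)).Adj a b ↔ (G.map ident).Adj a b := by
  obtain ⟨u, rfl, hu⟩ := (edist_map_le_iff hinj).1 ha
  rw [viewGraph, SimpleGraph.fromEdgeSet_adj]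
  constructor
  · rintro ⟨⟨x, y, hxy, -, -, -, he⟩, -⟩
    rw [Sym2.eq_iff] at he
    rcases he with ⟨hx, rfl⟩ | ⟨hy, rfl⟩
    · exact hx ▸ (map_adj_iff hinj).2 hxy
    · exact hy ▸ (map_adj_iff hinj).2 hxy.symm
  · rintro ⟨hne, x, w, huw, hx, rfl⟩
    obtain rfl := hinj hx
    have hlt : G.edist v x < (r + 1 : ℕ) := hu.trans_lt (by exact_mod_cast r.lt_succ_self)
    exact ⟨⟨x, w, huw, hlt.le, edist_le_succ_iff.2 (.inr ⟨x, hu, huw⟩), fun h ↦ hlt.ne h.1, rfl⟩,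
      hne⟩

lemma readCertificate_viewAt (hinj : Function.Injective ident) {a : ℕ}
    (ha : (G.map ident).edist (ident v) a ≤ n) :
    readCertificate (viewAt G ident cert n v).labels a =
      readCertificate (Set.range fun u ↦ (ident u, cert u)) a := by
  obtain ⟨u, rfl, hu⟩ := (edist_map_le_iff hinj).1 ha
  have hmem (C : Certificate ℕ) : (ident u, certificateCode C) ∈ (viewAt G ident cert n v).labels ↔
      (ident u, certificateCode C) ∈ Set.range fun u ↦ (ident u, cert u) := by
    constructor
    · rintro ⟨w, -, hw⟩
      exact ⟨w, hw.symm⟩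
    · rintro ⟨w, hw⟩
      obtain rfl := hinj (Prod.mk.inj hw).1
      exact ⟨w, hu, hw.symm⟩
  simp only [readCertificate, hmem]

lemma readCertificate_range (hinj : Function.Injective ident) (Φ : ℕ → Certificate ℕ) (u : V) :
    readCertificate (Set.range fun u ↦ (ident u, certificateCode (Φ (ident u)))) (ident u) =
      Φ (ident u) := by
  obtain ⟨w, hw⟩ := Classical.epsilon_spec (p := fun C ↦ (ident u, certificateCode C) ∈
    Set.range fun u ↦ (ident u, certificateCode (Φ (ident u)))) ⟨_, u, rfl⟩
  obtain ⟨hwu, hcode⟩ := Prod.mk.inj hw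
  rw [hinj hwu] at hcode
  exact (isPrefixCode_certificateCode.injective hcode).symm

theorem verifies_viewAt_iff (hinj : Function.Injective ident) :
    Verifies r N (viewAt G ident cert (r + 1) v) ↔
      ∃ Γ, IsPlausible (G.map ident) (readCertificate (Set.range fun u ↦ (ident u, cert u))) r N
        (ident v) Γ := by
  have hadj (a : ℕ) (ha : (G.map ident).edist (ident v) a ≤ r) (b : ℕ) :=
    viewGraph_viewAt_adj_iff (cert := cert) (b := b) hinj ha
  have hedist {n a : ℕ} (hn : n ≤ r + 1) := edist_le_iff_of_adj_iff (z := a) hadj hn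
  refine exists_congr fun Γ ↦ ⟨fun h ↦ h.congr (fun a ha b ↦ ?_) fun u hu ↦ ?_,
    fun h ↦ h.congr hadj fun u hu ↦ readCertificate_viewAt hinj hu⟩
  · exact (hadj a ((hedist r.le_succ).1 ha) b).symm
  · exact (readCertificate_viewAt hinj ((hedist le_rfl).1 hu)).symm

theorem inducedFree_pathGraph_of_verifies (hinj : Function.Injective ident) (hr : 1 ≤ r)
    (hN2 : 2 ≤ N) (hN : 3 * N < 14 * (r + 1))
    (h : ∀ v, Verifies r N (viewAt G ident cert (r + 1) v)) :
    InducedFree (SimpleGraph.pathGraph N) G := by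
  rw [InducedFree, isIndContained_pathGraph_iff hinj hN2]
  rintro ⟨p, hp⟩
  refine not_isInducedOn_of_isPlausible hr hN2 hN
    (Φ := readCertificate (Set.range fun u ↦ (ident u, cert u))) ?_ p hp
  rintro _ ⟨_, -, v, _, -, rfl, -⟩
  exact (verifies_viewAt_iff hinj).1 (h v)

theorem exists_cert_forall_verifies [Fintype V] {c : ℕ} (hident : IsIdentifierAssignment c ident)
    (r : ℕ) (hN : 2 ≤ N) (hfree : InducedFree (SimpleGraph.pathGraph N) G) :
    ∃ cert : V → List Bool,
      (∀ v, (cert v).length ≤ certificateLength c #(patterns r N)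
        ((patterns r N).sup fun π ↦ (patternCode π).length) (Fintype.card V)) ∧
      ∀ v, Verifies r N (viewAt G ident cert (r + 1) v) := by
  obtain ⟨hinj, hle⟩ := hident
  let X := Finset.univ.image ident
  have hcard : #X = Fintype.card V := Finset.card_image_of_injective _ hinj
  have hX : (G.map ident).support ⊆ X := by
    rintro _ ⟨_, -, u, _, -, rfl, -⟩
    simp [X]
  rw [InducedFree, isIndContained_pathGraph_iff hinj hN] at hfree
  obtain ⟨Φ, hΦ⟩ := exists_certificates r hX hfree (Nat.sqrt #X).succ_pos
    (Nat.lt_succ_sqrt _).le (mul_sqrt_add_one_lt #X)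
  rw [hcard] at hΦ
  refine ⟨fun v ↦ certificateCode (Φ (ident v)), fun v ↦ ?_, fun v ↦ ?_⟩
  · exact length_certificateCode_le_certificateLength (hΦ (ident v)).2.1
      (Fintype.card_pos_iff.2 ⟨v⟩) (by simpa [X] using fun u ↦ (hle u).2) (hΦ (ident v)).2.2
  · rw [verifies_viewAt_iff hinj]
    refine ⟨_, (hΦ (ident v)).1.congr (fun _ _ _ ↦ Iff.rfl) fun a ha ↦ ?_⟩
    obtain ⟨u, rfl, -⟩ := (edist_map_le_iff hinj).1 ha
    exact readCertificate_range hinj Φ u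

end Network

theorem mainTheorem2_general {k N : ℕ} (hk : 2 ≤ k) (hN2 : 2 ≤ N) (hN : 3 * N < 14 * k) (c : ℕ) :
    ∃ s : ℕ → ℕ,
      (fun n : ℕ ↦ (s n : ℝ)) =O[atTop]
        (fun n : ℕ ↦ (n : ℝ) ^ (3 / 2 : ℝ) * Real.log (n : ℝ) ^ 2) ∧
      HasLocalCertification (fun _ G ↦ InducedFree (SimpleGraph.pathGraph N) G) k c s := by
  classical
  obtain ⟨r, rfl⟩ : ∃ r, k = r + 1 := ⟨k - 1, by omega⟩
  refine ⟨_, isBigO_certificateLength c #(patterns r N)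
    ((patterns r N).sup fun π ↦ (patternCode π).length), fun view ↦ decide (Verifies r N view),
    fun V _ G ident hident ↦ ⟨fun hfree ↦ ?_, fun hnot cert ↦ ?_⟩⟩
  · obtain ⟨cert, hlength, hcert⟩ := exists_cert_forall_verifies hident r hN2 hfree
    exact ⟨cert, hlength, fun v ↦ decide_eq_true (hcert v)⟩
  · contrapose! hnot
    exact inducedFree_pathGraph_of_verifies hident.1 (by omega) hN2 hN
      fun v ↦ by simpa using hnot v

lemma three_mul_ceil_sub_one_lt {k : ℕ} (hk : 1 ≤ k) :
    3 * (⌈(14 / 3 : ℚ) * (k : ℚ)⌉₊ - 1) < 14 * k := by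
  have hpos : (0 : ℚ) < 14 / 3 * k := by positivity
  have hlt := Nat.ceil_lt_add_one hpos.le
  have hceil := Nat.ceil_pos.2 hpos
  have h : 3 * (⌈(14 / 3 : ℚ) * (k : ℚ)⌉₊ : ℚ) < 14 * k + 3 := by linarith
  have : 3 * ⌈(14 / 3 : ℚ) * (k : ℚ)⌉₊ < 14 * k + 3 := by exact_mod_cast h
  omega

lemma two_le_ceil_sub_one {k : ℕ} (hk : 1 ≤ k) : 2 ≤ ⌈(14 / 3 : ℚ) * (k : ℚ)⌉₊ - 1 := by
  have hk' : (1 : ℚ) ≤ k := by exact_mod_cast hk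
  have : 4 < ⌈(14 / 3 : ℚ) * (k : ℚ)⌉₊ := Nat.lt_ceil.2 (by push_cast; linarith)
  omega

theorem mainTheorem2 (k : ℕ) (hk : 2 ≤ k) (c : ℕ) :
    ∃ s : ℕ → ℕ,
      (fun n : ℕ => (s n : ℝ)) =O[atTop]
        (fun n : ℕ => (n : ℝ) ^ (3 / 2 : ℝ) * Real.log (n : ℝ) ^ 2) ∧
      HasLocalCertification
        (fun _ G => InducedFree (SimpleGraph.pathGraph (⌈(14 / 3 : ℚ) * (k : ℚ)⌉₊ - 1)) G)
        k c s :=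
  mainTheorem2_general hk (two_le_ceil_sub_one (by omega)) (three_mul_ceil_sub_one_lt (by omega)) c
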